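/- **Affine Euler–Poincaré theorem for vertical slice models.** Let $M\subseteq\mathbb R^2$ be a closed set in which its interior is dense, with Lebesgue measure $d^2x$, and let $s\in\mathbb R$. Smooth fields on $M$ (and families of fields depending on parameters) are restrictions of smooth maps on the whole plane (times the parameter space). Let $\mathcal F(M)$ be the smooth functions on $M$, $\operatorname{Den}(M)$ the smooth densities $D\,d^2x$, and $\mathfrak X(M)$ the smooth vector fields on $M$ tangent to the boundary, i.e. $u(p)\cdot(y-p)=0$ whenever $p\in M$ is a point of $M$ nearest to $y\in\mathbb R^2$. Let $S=\operatorname{Diff}(M)\ltimes\mathcal F(M)$ with product $(\phi_1,v_1)(\phi_2,v_2)=(\phi_1\phi_2,\,v_1\circ\phi_2+v_2)$ and one-cocycle $c(\phi,v)=sv$, and $\mathfrak s=\mathfrak X(M)\ltimes\mathcal F(M)$ with $$\operatorname{ad}_{(u_S,u_T)}(v_S,v_T)=\big(\operatorname{ad}_{u_S}v_S,\ \mathcal L_{v_S}u_T-\mathcal L_{u_S}v_T\big),\qquad \operatorname{ad}_{u}v=-(u\cdot\nabla v-v\cdot\nabla u).$$ Here $\mathcal L_va=v\cdot\nabla a$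 for functions and $\mathcal L_v(D\,d^2x)=\nabla\cdot(Dv)\,d^2x$ for densities. For one-form densities $m$ put $\operatorname{ad}^*_um=u\cdot\nabla m+(\nabla u)^{T}m+(\nabla\cdot u)\,m$; for a density $b$ and a function $a$ put $b\diamond a=-b\,\nabla a$; for a function $b$ and a density $D$ put $b\diamond D=D\,\nabla b$. Pairings $\langle\cdot,\cdot\rangle$ are integrals over $M$. 1. *(Constrained variations.)* Let $(\phi_{\epsilon,t},v_{\epsilon,t})$ be a smooth two-parameter family in $S$ ($\phi$, $\phi^{-1}$ and $v$ smooth jointly in the parameters and the point), $D_0\,d^2x\in\operatorname{Den}(M)$ and $\vartheta_0\in\mathcal F(M)$. Then $$(u_S,u_T)=(\dot\phi\,\phi^{-1},\ \phi_*\dot v),\qquad D\,d^2x=\phi_*(D_0\,d^2x),\qquad \vartheta_s=\phi_*\vartheta_0+c((\phi,v)^{-1})=\phi_*\vartheta_0-s\,\phi_*v$$ define a smooth family in $(\mathfrak X(M)\ltimes\mathcal F(M))\times\operatorname{Den}(M)\times\mathcal F(M)$, $(v_S,v_T)=(\delta\phi\,\phi^{-1},\phi_*\delta v)$ is a smooth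 curve in $\mathfrak s$, where $\delta=\partial_\epsilon|_{\epsilon=0}$, and $$\delta(u_S,u_T)=\partial_t(v_S,v_T)-\operatorname{ad}_{(u_S,u_T)}(v_S,v_T),\quad \delta D=-\mathcal L_{v_S}D,\quad \delta\vartheta_s=-\mathcal L_{v_S}\vartheta_s-s\,v_T.\tag{$*$}$$ 2. *(Duality.)* For $u,v\in\mathfrak X(M)$ with $v$ of bounded support, $\langle\operatorname{ad}^*_um,v\rangle=\langle m,\operatorname{ad}_uv\rangle$ for all smooth one-form densities $m$, and $-\langle b\diamond a,v\rangle=\langle\mathcal L_va,b\rangle$ for both kinds of diamond. 3. *(Affine Euler–Poincaré equations.)* Let $\ell:(\mathfrak X(M)\ltimes\mathcal F(M))\times\operatorname{Den}(M)\times\mathcal F(M)\to\mathbb R$, let $t_0<t_1$, and let $q(t)=(u_S,u_T,D,\vartheta_s)(t)$ be a smooth curve. Call a smooth family $q_\epsilon(t)$ with $q_0=q$ that differs from $q$ only in a bounded region of $M$ a deformation of $q$. Assume that $\ell(q_\epsilon(t))$ is $C^1$ in $(\epsilon,t)$ near $\{0\}\times[t_0,t_1]$ for every deformation, and that $\ell$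 has, at $q(t)$ for $t\in[t_0,t_1]$, variational derivatives $\frac{\delta\ell}{\delta u_S}$ (a one-form density), $\frac{\delta\ell}{\delta u_T}$, $\frac{\delta\ell}{\delta\vartheta_s}$ (densities) and $\frac{\delta\ell}{\delta D}$ (a function), depending smoothly on $(t,x)$; that is, the derivative of $\ell$ at $q(t)$ along every smooth curve through $q(t)$ that changes it only in a bounded region is the sum of the pairings of these with the components of the velocity of the curve. Then Hamilton's principle $$\frac{d}{d\epsilon}\Big|_{\epsilon=0}\int_{t_0}^{t_1}\ell(q_\epsilon(t))\,dt=0,$$ for all deformations whose infinitesimal variation on $[t_0,t_1]$ has the form $(*)$ for some smooth curve $(v_S,v_T)$ in $\mathfrak s$ that vanishes at $t_0$ and $t_1$ and has bounded support in space (automatic if $M$ is bounded), holds if and only if on $[t_0,t_1]\times M$ $$(\partial_t+\operatorname{ad}^*_{u_S})\frac{\delta\ell}{\delta u_S}=\frac{\delta\ell}{\delta u_T}\diamond u_T+\frac{\delta\ell}{\delta D}\diamond D+\frac{\delta\ell}{\delta\vartheta_s}\diamond\vartheta_s,\qquad (\partial_t+\mathcal L_{u_S})\frac{\delta\ell}{\delta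 u_T}=-s\,\frac{\delta\ell}{\delta\vartheta_s}.$$ -/

import Mathlib

open MeasureTheory Set
open scoped ContDiff

noncomputable section

namespace VSM

/-- The plane that contains the slice, with coordinates `(x, z)`. -/
abbrev Plane := EuclideanSpace ℝ (Fin 2)

/-! ### Smooth fields on the slice

The slice is a closed set `M` in which the interior is dense. A field on `M` is smooth (up to the
boundary) if it is the restriction of a smooth map defined on the whole plane. -/

/-- Smooth `F`-valued fields on `M`. -/
def Smooth (M : Set Plane) (F : Type*) [NormedAddCommGroup F] [NormedSpace ℝ F] :
    Submodule ℝ (M → F) where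
  carrier := {f | ∃ g : Plane → F, ContDiff ℝ ∞ g ∧ ∀ x : M, f x = g x}
  add_mem' := by
    rintro f₁ f₂ ⟨g₁, h₁, e₁⟩ ⟨g₂, h₂, e₂⟩
    exact ⟨fun x => g₁ x + g₂ x, h₁.add h₂, fun x => by simp [e₁, e₂]⟩
  zero_mem' := ⟨fun _ => 0, contDiff_const, fun _ => rfl⟩
  smul_mem' := by
    rintro c f ⟨g, h, e⟩
    exact ⟨fun x => c • g x, contDiff_const.smul h, fun x => by simp [e]⟩

/-- `𝓕(M)`: smooth functions on `M`. -/
abbrev Fun (M : Set Plane) := Smooth M ℝ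

/-- `Den(M)`: smooth densities `D d²x` on `M`, given by their coefficient `D`. -/
abbrev Den (M : Set Plane) := Smooth M ℝ

/-- Smooth one-form densities `m ⊗ d²x` on `M`, given by their coefficient `m`. -/
abbrev OneFormDen (M : Set Plane) := Smooth M (Plane →L[ℝ] ℝ)

/-- `𝔛(M)`: smooth vector fields on `M` that are tangent to the boundary, that is, orthogonal at
every `p ∈ M` to every exterior normal `y - p`, where `p` is a point of `M` nearest to `y`. At
interior points the condition is empty. -/
def Vec (M : Set Plane) : Submodule ℝ (Smooth M Plane) where
  carrier := {u | ∀ (p : M) (y : Plane), (∀ z ∈ M, dist y p ≤ dist y z) →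
    inner ℝ ((u : M → Plane) p) (y - p) = 0}
  add_mem' := by
    intro u v hu hv p y h
    simp [inner_add_left, hu p y h, hv p y h]
  zero_mem' := by
    intro p y h
    simp
  smul_mem' := by
    intro c u hu p y h
    simp [inner_smul_left, hu p y h]

/-- `𝔰 = 𝔛(M) ⋉ 𝓕(M)`, elements `(u_S, u_T)`. -/
abbrev Alg (M : Set Plane) := Vec M × Fun M

section Calculus

variable {M : Set Plane} {F : Type*} [NormedAddCommGroup F] [NormedSpace ℝ F]

/-- The value of a smooth field at a point. -/
def val (a : Smooth M F) (x : M) : F := (a : M → F) x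

/-- The value of a vector field at a point. -/
def vval (u : Vec M) (x : M) : Plane := val (u : Smooth M Plane) x

/-- The derivative of a smooth field at a point of `M`, boundary points included: the derivative
of a smooth extension. -/
def d (a : Smooth M F) (x : M) : Plane →L[ℝ] F := fderiv ℝ a.2.choose x

/-- The derivative does not depend on the extension, since the interior of `M` is dense in `M`. -/
theorem d_eq (hM : M ⊆ closure (interior M)) (a : Smooth M F) (g : Plane → F)
    (hg : ContDiff ℝ ∞ g) (h : ∀ x : M, val a x = g x) (x : M) : d a x = fderiv ℝ g x := by
  have h1 := a.2.choose_spec.1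
  have h2 := a.2.choose_spec.2
  have hc : IsClosed {y : Plane | fderiv ℝ a.2.choose y = fderiv ℝ g y} :=
    isClosed_eq (h1.continuous_fderiv (by simp)) (hg.continuous_fderiv (by simp))
  have hi : interior M ⊆ {y : Plane | fderiv ℝ a.2.choose y = fderiv ℝ g y} := by
    intro y hy
    apply Filter.EventuallyEq.fderiv_eq
    filter_upwards [isOpen_interior.mem_nhds hy] with z hz
    have hz' : z ∈ M := interior_subset hz
    exact (h2 ⟨z, hz'⟩).symm.trans (h ⟨z, hz'⟩)
  exact closure_minimal hi hc (hM x.2)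

/-- The derivative of a vector field. -/
def dv (u : Vec M) (x : M) : Plane →L[ℝ] Plane := d (u : Smooth M Plane) x

/-- The divergence of a vector field. -/
def div (u : Vec M) (x : M) : ℝ :=
  ∑ i : Fin 2, dv u x (EuclideanSpace.single i 1) i

/-- The Lie derivative `𝓛_v a` of a function. -/
def lieFun (v : Vec M) (a : Fun M) (x : M) : ℝ := d a x (vval v x)

/-- The Lie derivative `𝓛_v (D d²x) = div (D v) d²x` of a density. -/
def lieDen (v : Vec M) (D : Den M) (x : M) : ℝ :=
  d D x (vval v x) + val D x * div v x

/-- The commutator `u · ∇ v - v · ∇ u` of vector fields. -/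
def bracket (u v : Vec M) (x : M) : Plane := dv v x (vval u x) - dv u x (vval v x)

/-- The adjoint action `ad_u v` of the Lie algebra of `Diff(M)`, minus the commutator. -/
def adVec (u v : Vec M) (x : M) : Plane := - bracket u v x

/-- The adjoint action of `𝔰` on itself,
`ad_{(u_S,u_T)} (v_S,v_T) = (ad_{u_S} v_S, 𝓛_{v_S} u_T - 𝓛_{u_S} v_T)`. -/
def ad (u v : Alg M) : (M → Plane) × (M → ℝ) :=
  (adVec u.1 v.1, fun x => lieFun v.1 u.2 x - lieFun u.1 v.2 x)

/-- The coadjoint action `ad*_u m` on one-form densities. -/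
def adStar (u : Vec M) (m : OneFormDen M) (x : M) : Plane →L[ℝ] ℝ :=
  d m x (vval u x) + (val m x).comp (dv u x) + div u x • val m x

/-- The diamond `b ⋄ a` of a density `b` and a function `a`. -/
def diamondFun (b : Den M) (a : Fun M) (x : M) : Plane →L[ℝ] ℝ :=
  - (val b x • d a x)

/-- The diamond `b ⋄ D` of a function `b` and a density `D`. -/
def diamondDen (b : Fun M) (D : Den M) (x : M) : Plane →L[ℝ] ℝ :=
  val D x • d b x

/-- Lebesgue measure on `M`. -/
def area (M : Set Plane) : Measure M := Measure.comap Subtype.val volume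

/-- The pairing of one-form densities with vector fields. -/
def pairVec (m : M → (Plane →L[ℝ] ℝ)) (v : M → Plane) : ℝ := ∫ x, m x (v x) ∂(area M)

/-- The pairing of functions with densities. -/
def pairFun (b a : M → ℝ) : ℝ := ∫ x, b x * a x ∂(area M)

/-- Vector fields with bounded support; on a bounded `M`, all of them. -/
def BddSupp (v : Vec M) : Prop := ∃ R : ℝ, ∀ x : M, R < ‖(x : Plane)‖ → vval v x = 0

/-- A family of smooth fields that depends smoothly on a parameter, jointly with the point. -/
def SmoothFamily {P : Type*} [NormedAddCommGroup P] [NormedSpace ℝ P] (f : P → M → F) : Prop :=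
  ∃ g : P × Plane → F, ContDiff ℝ ∞ g ∧ ∀ (p : P) (x : M), f p x = g (p, (x : Plane))

end Calculus

/-! ### The semidirect-product group and the one-cocycle -/

theorem Smooth.comp_mem {M : Set Plane} {F : Type*} [NormedAddCommGroup F] [NormedSpace ℝ F]
    {a : M → F} (ha : a ∈ Smooth M F) {f : M → M}
    (hf : (fun x => (f x : Plane)) ∈ Smooth M Plane) : (fun x => a (f x)) ∈ Smooth M F := by
  obtain ⟨g, hg, e⟩ := ha
  obtain ⟨k, hk, e'⟩ := hf
  refine ⟨fun x => g (k x), hg.comp hk, fun x => ?_⟩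
  have h := e' x
  simp only at h ⊢
  rw [e, h]

/-- `S = Diff(M) ⋉ 𝓕(M)`: pairs `(φ, v)` of a diffeomorphism of `M` and a smooth function. -/
@[ext]
structure SliceGroup (M : Set Plane) where
  φ : M ≃ M
  v : M → ℝ
  smooth_φ : (fun x => (φ x : Plane)) ∈ Smooth M Plane
  smooth_symm : (fun x => (φ.symm x : Plane)) ∈ Smooth M Plane
  smooth_v : v ∈ Smooth M ℝ

namespace SliceGroup

variable {M : Set Plane}

/-- `(φ₁, v₁) (φ₂, v₂) = (φ₁ φ₂, v₁ φ₂ + v₂)`. -/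
instance : Mul (SliceGroup M) where
  mul g h :=
    { φ := h.φ.trans g.φ
      v := fun x => g.v (h.φ x) + h.v x
      smooth_φ := Smooth.comp_mem g.smooth_φ h.smooth_φ
      smooth_symm := Smooth.comp_mem h.smooth_symm g.smooth_symm
      smooth_v := (Smooth M ℝ).add_mem (Smooth.comp_mem g.smooth_v h.smooth_φ) h.smooth_v }

instance : One (SliceGroup M) where
  one :=
    { φ := Equiv.refl M
      v := 0
      smooth_φ := ⟨id, contDiff_id, fun _ => rfl⟩
      smooth_symm := ⟨id, contDiff_id, fun _ => rfl⟩
      smooth_v := (Smooth M ℝ).zero_mem }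

instance : Inv (SliceGroup M) where
  inv g :=
    { φ := g.φ.symm
      v := fun x => - g.v (g.φ.symm x)
      smooth_φ := g.smooth_symm
      smooth_symm := g.smooth_φ
      smooth_v := (Smooth M ℝ).neg_mem (Smooth.comp_mem g.smooth_v g.smooth_symm) }

theorem mul_φ (g h : SliceGroup M) : (g * h).φ = h.φ.trans g.φ := rfl
theorem mul_v (g h : SliceGroup M) (x : M) : (g * h).v x = g.v (h.φ x) + h.v x := rfl
theorem one_φ : (1 : SliceGroup M).φ = Equiv.refl M := rfl
theorem one_v (x : M) : (1 : SliceGroup M).v x = 0 := rfl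
theorem inv_φ (g : SliceGroup M) : g⁻¹.φ = g.φ.symm := rfl
theorem inv_v (g : SliceGroup M) (x : M) : g⁻¹.v x = - g.v (g.φ.symm x) := rfl

instance : Group (SliceGroup M) :=
  Group.ofLeftAxioms
    (fun a b c => by
      apply SliceGroup.ext
      · rfl
      · funext x
        simp [mul_v, mul_φ, add_assoc])
    (fun a => by
      apply SliceGroup.ext
      · rfl
      · funext x
        simp [mul_v, one_v])
    (fun a => by
      apply SliceGroup.ext
      · simp [mul_φ, inv_φ, one_φ]
      · funext x
        simp [mul_v, inv_v, one_v])

/-- The derivative of the diffeomorphism `φ` at a point of `M`. -/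
def dφ (g : SliceGroup M) (x : M) : Plane →L[ℝ] Plane :=
  d (⟨fun y => (g.φ y : Plane), g.smooth_φ⟩ : Smooth M Plane) x

/-- The one-cocycle `c(φ, v) = s v`. -/
def cocycle (s : ℝ) (g : SliceGroup M) (x : M) : ℝ := s * g.v x

end SliceGroup

/-- A family in `S` that depends smoothly on a parameter: `φ`, `φ⁻¹` and `v` do. -/
def SmoothGroupFamily {M : Set Plane} {P : Type*} [NormedAddCommGroup P] [NormedSpace ℝ P]
    (g : P → SliceGroup M) : Prop :=
  SmoothFamily (fun p (x : M) => ((g p).φ x : Plane)) ∧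
  SmoothFamily (fun p (x : M) => ((g p).φ.symm x : Plane)) ∧
  SmoothFamily (fun p (x : M) => (g p).v x)

/-! ### States, variations and the reduced Lagrangian -/

/-- A point `(u_S, u_T, D, ϑ_s)` of `(𝔛(M) ⋉ 𝓕(M)) × Den(M) × 𝓕(M)`. -/
structure State (M : Set Plane) where
  u : Alg M
  D : Den M
  θ : Fun M

/-- Variations `(δu_S, δu_T, δD, δϑ_s)`. -/
structure Variation (M : Set Plane) where
  uS : M → Plane
  uT : M → ℝ
  D : M → ℝ
  θ : M → ℝ

/-- Values `(δℓ/δu_S, δℓ/δu_T, δℓ/δD, δℓ/δϑ_s)` of the variational derivatives: a one-form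
density, a density, a function and a density. -/
structure Costate (M : Set Plane) where
  uS : OneFormDen M
  uT : Den M
  D : Fun M
  θ : Den M

section Variational

variable {M : Set Plane} {P : Type*} [NormedAddCommGroup P] [NormedSpace ℝ P]

def SmoothStateFamily (q : P → State M) : Prop :=
  SmoothFamily (fun p => vval (q p).u.1) ∧ SmoothFamily (fun p => val (q p).u.2) ∧
  SmoothFamily (fun p => val (q p).D) ∧ SmoothFamily (fun p => val (q p).θ)

def SmoothCostateFamily (μ : P → Costate M) : Prop :=
  SmoothFamily (fun p => val (μ p).uS) ∧ SmoothFamily (fun p => val (μ p).uT) ∧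
  SmoothFamily (fun p => val (μ p).D) ∧ SmoothFamily (fun p => val (μ p).θ)

def SmoothAlgFamily (v : P → Alg M) : Prop :=
  SmoothFamily (fun p => vval (v p).1) ∧ SmoothFamily (fun p => val (v p).2)

/-- Equality of two states at a point. -/
def EqAt (c c' : State M) (x : M) : Prop :=
  vval c.u.1 x = vval c'.u.1 x ∧ val c.u.2 x = val c'.u.2 x ∧
  val c.D x = val c'.D x ∧ val c.θ x = val c'.θ x

/-- The velocity of a curve of states. -/
def velocity (C : ℝ → State M) (e : ℝ) : Variation M where
  uS x := deriv (fun r => vval (C r).u.1 x) e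
  uT x := deriv (fun r => val (C r).u.2 x) e
  D x := deriv (fun r => val (C r).D x) e
  θ x := deriv (fun r => val (C r).θ x) e

/-- The pairing of variational derivatives with variations. -/
def pairing (μ : Costate M) (w : Variation M) : ℝ :=
  pairVec (val μ.uS) w.uS + pairFun (val μ.uT) w.uT + pairFun (val μ.D) w.D +
    pairFun (val μ.θ) w.θ

/-- `μ` is the variational derivative of `ℓ` at the state `c`: along every smooth curve of states
through `c` that moves `c` only in a bounded region, the derivative of `ℓ` is the pairing of `μ`
with the velocity. -/
def IsVariationalDerivative (ℓ : State M → ℝ) (c : State M) (μ : Costate M) : Prop :=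
  ∀ C : ℝ → State M, SmoothStateFamily C → C 0 = c →
    (∃ R : ℝ, ∀ (e : ℝ) (x : M), R < ‖(x : Plane)‖ → EqAt (C e) c x) →
    HasDerivAt (fun e => ℓ (C e)) (pairing μ (velocity C 0)) 0

/-- A smooth deformation `Q (ε, t)`, in a bounded region, of a curve of states `q t = Q (0, t)`. -/
def IsDeformation (q : ℝ → State M) (Q : ℝ × ℝ → State M) : Prop :=
  SmoothStateFamily Q ∧ (∀ t, Q (0, t) = q t) ∧
  ∃ R : ℝ, ∀ (p : ℝ × ℝ) (x : M), R < ‖(x : Plane)‖ → EqAt (Q p) (q p.2) x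

/-- `ℓ` is continuously differentiable along the smooth deformations of the curve `q`. -/
def IsC1Along (ℓ : State M → ℝ) (t₀ t₁ : ℝ) (q : ℝ → State M) : Prop :=
  ∀ Q : ℝ × ℝ → State M, IsDeformation q Q →
    ∀ t ∈ Icc t₀ t₁, ContDiffAt ℝ 1 (fun p => ℓ (Q p)) (0, t)

/-- The constrained variation of the curve `q` generated by the curve `v = (v_S, v_T)` in `𝔰`:
`δ(u_S, u_T) = ∂ₜ (v_S, v_T) - ad_{(u_S, u_T)} (v_S, v_T)`, `δD = - 𝓛_{v_S} D`,
`δϑ_s = - 𝓛_{v_S} ϑ_s - s v_T`. -/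
def constrainedVariation (s : ℝ) (q : ℝ → State M) (v : ℝ → Alg M) (t : ℝ) :
    Variation M where
  uS x := deriv (fun τ => vval (v τ).1 x) t - (ad (q t).u (v t)).1 x
  uT x := deriv (fun τ => val (v τ).2 x) t - (ad (q t).u (v t)).2 x
  D x := - lieDen (v t).1 (q t).D x
  θ x := - lieFun (v t).1 (q t).θ x - s * val (v t).2 x

/-- Admissible generators of variations: smooth curves in `𝔰` that vanish at the end times, with
bounded support in space. -/
def IsAdmissible (t₀ t₁ : ℝ) (v : ℝ → Alg M) : Prop :=
  SmoothAlgFamily v ∧ v t₀ = 0 ∧ v t₁ = 0 ∧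
  ∃ R : ℝ, ∀ (t : ℝ) (x : M), R < ‖(x : Plane)‖ → vval (v t).1 x = 0 ∧ val (v t).2 x = 0

/-- Hamilton's principle `δ ∫ ℓ dt = 0` with constrained variations: the action is stationary
along every deformation of `q` whose infinitesimal variation is generated by an admissible
curve in `𝔰`. -/
def HamiltonPrinciple (s : ℝ) (ℓ : State M → ℝ) (t₀ t₁ : ℝ) (q : ℝ → State M) : Prop :=
  ∀ (Q : ℝ × ℝ → State M) (v : ℝ → Alg M), IsDeformation q Q → IsAdmissible t₀ t₁ v →
    (∀ t ∈ Icc t₀ t₁, velocity (fun e => Q (e, t)) 0 = constrainedVariation s q v t) →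
    HasDerivAt (fun e => ∫ t in t₀..t₁, ℓ (Q (e, t))) 0 0

/-- The affine Euler–Poincaré equations for the curve `q`, with variational derivatives `μ`. -/
def AffineEulerPoincare (s t₀ t₁ : ℝ) (q : ℝ → State M) (μ : ℝ → Costate M) : Prop :=
  ∀ t ∈ Icc t₀ t₁, ∀ x : M,
    deriv (fun τ => val (μ τ).uS x) t + adStar (q t).u.1 (μ t).uS x =
      diamondFun (μ t).uT (q t).u.2 x + diamondDen (μ t).D (q t).D x +
        diamondFun (μ t).θ (q t).θ x ∧
    deriv (fun τ => val (μ τ).uT x) t + lieDen (q t).u.1 (μ t).uT x = - (val (μ t).θ x * s)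

/-- The curve of states defined by a curve `(φ, v)` in `S` and initial data `D₀`, `ϑ₀`:
`u_S = φ̇ φ⁻¹`, `u_T = φ_* v̇`, `D d²x = φ_* (D₀ d²x)`, and `ϑ_s = φ_* ϑ₀ + c((φ, v)⁻¹)`. -/
def IsInducedBy (s : ℝ) (D₀ : Den M) (θ₀ : Fun M) (g : ℝ → SliceGroup M)
    (q : ℝ → State M) : Prop :=
  ∀ (t : ℝ) (x : M),
    vval (q t).u.1 ((g t).φ x) = deriv (fun τ => ((g τ).φ x : Plane)) t ∧
    val (q t).u.2 ((g t).φ x) = deriv (fun τ => (g τ).v x) t ∧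
    val (q t).D ((g t).φ x) * ((g t).dφ x).det = val D₀ x ∧
    val (q t).θ x = val θ₀ ((g t).φ.symm x) + SliceGroup.cocycle s (g t)⁻¹ x

/-- The generator `(v_S, v_T) = (δφ φ⁻¹, φ_* δv)` of a variation `g (ε, t)` of a curve in `S`. -/
def IsGenerator (g : ℝ × ℝ → SliceGroup M) (v : ℝ → Alg M) : Prop :=
  ∀ (t : ℝ) (x : M),
    vval (v t).1 ((g (0, t)).φ x) = deriv (fun e => ((g (e, t)).φ x : Plane)) 0 ∧
    val (v t).2 ((g (0, t)).φ x) = deriv (fun e => (g (e, t)).v x) 0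

end Variational

end VSM

end

/-!
Conjugating by the flow turns the two mixed partial derivatives of `(φ, v)`, which agree, into
derivatives of the Eulerian fields, and their equality becomes the formula for `δ(u_S, u_T)`. The
formulas for `δD` and `δϑ_s` come from differentiating the two relations that define `D` and `ϑ_s`;
for `D` this uses Jacobi's formula for the derivative of the determinant.

All dualities rest on one fact: the divergence of a vector field of bounded support that is tangent
to `M` integrates to zero over `M`. No regularity of the boundary is needed. The function
`max 0 (1 - n dist(·, M))` is Lipschitz and equals `1` on `M`, and its gradient has size `n` in the
collar of width `1 / n` around `M`; there it points from `y` to the nearest point of `M`, where the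
field is orthogonal to it, so that its derivative along the field stays bounded and integrates to
`o(1)`.

For Hamilton's principle, the pairing of the variational derivatives with a constrained variation
is, up to total divergences and the time derivative of the Noether density, minus the pairing of
the defects of the two equations with the generator. Conversely, a generator that vanishes near the
boundary of `M` and has compact support comes from the deformation `q + ε w`, where `w` is its
constrained variation, and the fundamental lemma of the calculus of variations applies; the
equations extend to the boundary because the interior of `M` is dense.
-/

noncomputable section

namespace VSM

section DivergenceTheorem

open Filter Topology Metric
open scoped NNReal RealInnerProductSpace

section Collar

variable {X : Type*} [PseudoMetricSpace X] {M : Set X} {c : ℝ≥0} {y : X}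

/-- The cutoff that equals `1` on `M`, decreases linearly with the distance to `M` and vanishes at
distance `c⁻¹`. Its gradient is normal to `M`. -/
def collar (M : Set X) (c : ℝ≥0) (y : X) : ℝ := max 0 (1 - c * infDist y M)

theorem lipschitzWith_collar (M : Set X) (c : ℝ≥0) : LipschitzWith c (collar M c) := by
  refine LipschitzWith.const_max (LipschitzWith.of_dist_le_mul fun x y => ?_) 0
  have h := (lipschitz_infDist_pt M).dist_le_mul x y
  rw [Real.dist_eq, NNReal.coe_one, one_mul] at h
  rw [Real.dist_eq, sub_sub_sub_cancel_left, ← mul_sub, abs_mul, NNReal.abs_eq, abs_sub_comm]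
  gcongr

theorem collar_nonneg (M : Set X) (c : ℝ≥0) (y : X) : 0 ≤ collar M c y := le_max_left _ _

theorem collar_le_one (M : Set X) (c : ℝ≥0) (y : X) : collar M c y ≤ 1 :=
  max_le zero_le_one (sub_le_self _ (mul_nonneg c.2 infDist_nonneg))

theorem collar_eq_one (h : infDist y M = 0) : collar M c y = 1 := by simp [collar, h]

theorem collar_eq_zero (h : 1 ≤ c * infDist y M) : collar M c y = 0 :=
  max_eq_left (sub_nonpos.2 h)

theorem eventually_one_le_mul_infDist (h : infDist y M ≠ 0) :
    ∀ᶠ n : ℕ in atTop, 1 ≤ ((n : ℝ≥0) : ℝ) * infDist y M := by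
  have hpos : 0 < infDist y M := infDist_nonneg.lt_of_ne' h
  simpa using (tendsto_natCast_atTop_atTop.atTop_mul_const hpos).eventually_ge_atTop 1

theorem tendsto_collar (hM : IsClosed M) (hne : M.Nonempty) (y : X) :
    Tendsto (fun n : ℕ => collar M n y) atTop (𝓝 (M.indicator 1 y)) := by
  by_cases hy : y ∈ M
  · simp [collar_eq_one (infDist_zero_of_mem hy), hy]
  · have h : infDist y M ≠ 0 := mt (hM.mem_iff_infDist_zero hne).2 hy
    rw [indicator_of_notMem hy]
    refine tendsto_const_nhds.congr' ?_
    filter_upwards [eventually_one_le_mul_infDist h] with n hn using (collar_eq_zero hn).symm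

theorem tendsto_integral_collar_mul [MeasurableSpace X] [BorelSpace X] {ν : Measure X}
    (hM : IsClosed M) (hne : M.Nonempty) {k : X → ℝ} (hk : Integrable k ν) :
    Tendsto (fun n : ℕ => ∫ x, collar M n x * k x ∂ν) atTop (𝓝 (∫ x in M, k x ∂ν)) := by
  rw [← integral_indicator hM.measurableSet]
  refine tendsto_integral_of_dominated_convergence (fun x => ‖k x‖)
    (fun n => (lipschitzWith_collar M n).continuous.aestronglyMeasurable.mul
      hk.aestronglyMeasurable) hk.norm (fun n => Eventually.of_forall fun x => ?_)
    (Eventually.of_forall fun x => ?_)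
  · rw [norm_mul, Real.norm_of_nonneg (collar_nonneg M n x)]
    exact mul_le_of_le_one_left (norm_nonneg _) (collar_le_one M n x)
  · convert! (tendsto_collar hM hne x).mul_const (k x) using 1
    by_cases hx : x ∈ M <;> simp [hx]

end Collar

section CollarDerivative

variable {E : Type*} [NormedAddCommGroup E] [NormedSpace ℝ E] {M : Set E} {c : ℝ≥0} {y : E}

theorem fderiv_collar_eq_zero (h : infDist y M = 0 ∨ 1 ≤ c * infDist y M) :
    fderiv ℝ (collar M c) y = 0 := by
  rcases h with h | h
  · refine IsLocalMax.fderiv_eq_zero (Eventually.of_forall fun z => ?_)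
    rw [collar_eq_one h]
    exact collar_le_one M c z
  · refine IsLocalMin.fderiv_eq_zero (Eventually.of_forall fun z => ?_)
    rw [collar_eq_zero h]
    exact collar_nonneg M c z

theorem eventually_fderiv_collar_eq_zero (M : Set E) (y : E) :
    ∀ᶠ n : ℕ in atTop, fderiv ℝ (collar M n) y = 0 := by
  by_cases h : infDist y M = 0
  · exact Eventually.of_forall fun n => fderiv_collar_eq_zero (Or.inl h)
  · filter_upwards [eventually_one_le_mul_infDist h] with n hn
      using fderiv_collar_eq_zero (Or.inr hn)

end CollarDerivative

section Tangent

variable {E : Type*} [NormedAddCommGroup E] [InnerProductSpace ℝ E] {M : Set E}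

/-- A vector field on `E` is tangent to `M` if at every `p ∈ M` it is orthogonal to the exterior
normals `y - p`, where `p` is a point of `M` nearest to `y`. -/
def TangentTo (M : Set E) (W : E → E) : Prop :=
  ∀ p ∈ M, ∀ y : E, (∀ z ∈ M, dist y p ≤ dist y z) → ⟪W p, y - p⟫ = 0

theorem hasFDerivAt_norm {x : E} (hx : x ≠ 0) :
    HasFDerivAt (fun z : E => ‖z‖) (‖x‖⁻¹ • innerSL ℝ x) x := by
  have h := ((hasFDerivAt_id (𝕜 := ℝ) x).norm_sq).sqrt (by simpa using hx)
  simp only [id, Real.sqrt_sq (norm_nonneg _)] at h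
  convert h using 1
  ext w
  simp
  field_simp

theorem fderiv_collar_of_isNearest {c : ℝ≥0} {p y : E} (hp : p ∈ M)
    (hyp : infDist y M = dist y p) (hne : y ≠ p) (hc : c * infDist y M ≤ 1)
    (hd : DifferentiableAt ℝ (collar M c) y) :
    fderiv ℝ (collar M c) y = -((c : ℝ) • ‖y - p‖⁻¹ • innerSL ℝ (y - p)) := by
  -- The collar touches the differentiable function `1 - c ‖z - p‖` from above at `z = y`.
  have hcone : HasFDerivAt (fun z => 1 - c * ‖z - p‖)
      (-((c : ℝ) • ‖y - p‖⁻¹ • innerSL ℝ (y - p))) y :=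
    (((hasFDerivAt_norm (sub_ne_zero.2 hne)).comp y
      ((hasFDerivAt_id y).sub_const p)).const_mul (c : ℝ)).const_sub 1
  have hle : ∀ z, 1 - c * ‖z - p‖ ≤ collar M c z := fun z => by
    refine le_trans ?_ (le_max_right _ _)
    rw [← dist_eq_norm]
    gcongr
    exact infDist_le_dist_of_mem hp
  have heq : collar M c y = 1 - c * ‖y - p‖ := by
    rw [collar, max_eq_right (sub_nonneg.2 hc), hyp, dist_eq_norm]
  have hmin : IsLocalMin (fun z => collar M c z - (1 - c * ‖z - p‖)) y :=
    Eventually.of_forall fun z => by simpa [heq] using hle z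
  exact sub_eq_zero.1 (hmin.hasFDerivAt_eq_zero (hd.hasFDerivAt.sub hcone))

theorem abs_fderiv_collar_le [ProperSpace E] (hM : IsClosed M) (hne : M.Nonempty) {W : E → E}
    {L c : ℝ≥0} (hL : LipschitzWith L W) (hW : TangentTo M W) {y : E}
    (hd : DifferentiableAt ℝ (collar M c) y) : |fderiv ℝ (collar M c) y (W y)| ≤ L := by
  by_cases h : infDist y M = 0 ∨ 1 ≤ c * infDist y M
  · simp [fderiv_collar_eq_zero h]
  push Not at h
  obtain ⟨h0, h1⟩ := h
  obtain ⟨p, hp, hyp⟩ := hM.exists_infDist_eq_dist hne y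
  have hyp0 : y ≠ p := fun h => h0 (by rw [hyp, h, dist_self])
  have hperp : ⟪y - p, W p⟫ = 0 := by
    rw [real_inner_comm]
    exact hW p hp y fun z hz => hyp ▸ infDist_le_dist_of_mem hz
  have hinner : |⟪y - p, W y⟫| ≤ ‖y - p‖ * (L * ‖y - p‖) :=
    calc |⟪y - p, W y⟫| = |⟪y - p, W y - W p⟫| := by rw [inner_sub_right, hperp, sub_zero]
      _ ≤ ‖y - p‖ * ‖W y - W p‖ := abs_real_inner_le_norm _ _
      _ ≤ ‖y - p‖ * (L * ‖y - p‖) := by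
        gcongr
        simpa [dist_eq_norm] using hL.dist_le_mul y p
  have hpos : 0 < ‖y - p‖ := norm_pos_iff.2 (sub_ne_zero.2 hyp0)
  rw [fderiv_collar_of_isNearest hp hyp hyp0 h1.le hd]
  simp only [neg_apply, smul_apply, smul_eq_mul, abs_neg, abs_mul, innerSL_apply_apply,
    NNReal.abs_eq, abs_inv, abs_norm]
  calc (c : ℝ) * (‖y - p‖⁻¹ * |⟪y - p, W y⟫|)
      ≤ c * (‖y - p‖⁻¹ * (‖y - p‖ * (L * ‖y - p‖))) := by gcongr
    _ = (c * infDist y M) * L := by rw [hyp, dist_eq_norm]; field_simp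
    _ ≤ L := mul_le_of_le_one_left L.2 h1.le

end Tangent

section IntegrationByParts

variable {E : Type*} [NormedAddCommGroup E] [MeasurableSpace E] [BorelSpace E] {f : E → ℝ}
  {C : ℝ≥0}

theorem integral_fderiv_mul_eq_neg [NormedSpace ℝ E] [FiniteDimensional ℝ E] {ν : Measure E}
    [ν.IsAddHaarMeasure] (hf : LipschitzWith C f) {w : E → ℝ}
    (hw : ContDiff ℝ 1 w) (hc : HasCompactSupport w) (e : E) :
    ∫ x, fderiv ℝ f x e * w x ∂ν = - ∫ x, f x * fderiv ℝ w x e ∂ν := by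
  obtain ⟨L, hL⟩ := hw.lipschitzWith_of_hasCompactSupport hc (by simp)
  have hline : ∫ x, fderiv ℝ f x e * w x ∂ν = ∫ x, lineDeriv ℝ f x e * w x ∂ν := by
    refine integral_congr_ae ?_
    filter_upwards [hf.ae_differentiableAt] with x hx
    rw [hx.lineDeriv_eq_fderiv]
  rw [hline, hf.integral_lineDeriv_mul_eq hL hc, ← integral_neg]
  congr 1 with x
  rw [(hw.differentiable (by simp) x).lineDeriv_eq_fderiv, map_neg]
  ring

end IntegrationByParts

section Divergence

variable {E : Type*} [NormedAddCommGroup E] [InnerProductSpace ℝ E]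

/-- The divergence of a vector field on a Euclidean space. -/
def divergence (W : E → E) (x : E) : ℝ := LinearMap.trace ℝ E (fderiv ℝ W x)

variable {W : E → E}

theorem hasCompactSupport_divergence (hc : HasCompactSupport W) :
    HasCompactSupport (divergence W) :=
  (hc.fderiv (𝕜 := ℝ)).comp_left (g := fun A : E →L[ℝ] E => LinearMap.trace ℝ E A) (by simp)

variable [FiniteDimensional ℝ E]

theorem continuous_divergence (hW : ContDiff ℝ 1 W) : Continuous (divergence W) :=
  (LinearMap.continuous_of_finiteDimensional
    (LinearMap.trace ℝ E ∘ₗ ContinuousLinearMap.coeLM ℝ)).comp (hW.continuous_fderiv (by simp))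

variable [MeasurableSpace E] [BorelSpace E] {ν : Measure E} [ν.IsAddHaarMeasure]

theorem integral_mul_divergence_eq_neg {f : E → ℝ} {C : ℝ≥0} (hf : LipschitzWith C f)
    (hW : ContDiff ℝ 1 W) (hc : HasCompactSupport W) :
    ∫ x, f x * divergence W x ∂ν = - ∫ x, fderiv ℝ f x (W x) ∂ν := by
  let b := stdOrthonormalBasis ℝ E
  have hWb : ∀ i, ContDiff ℝ 1 fun x => ⟪b i, W x⟫ := fun i => contDiff_const.inner ℝ hW
  have hcb : ∀ i, HasCompactSupport fun x => ⟪b i, W x⟫ := fun i =>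
    hc.comp_left (g := fun w => ⟪b i, w⟫) (inner_zero_right _)
  have hdiv : ∀ x, f x * divergence W x = ∑ i, f x * fderiv ℝ (fun y => ⟪b i, W y⟫) x (b i) := by
    intro x
    rw [divergence, LinearMap.trace_eq_sum_inner _ b, Finset.mul_sum]
    refine Finset.sum_congr rfl fun i _ => ?_
    rw [fderiv_inner_apply ℝ (by fun_prop) (hW.differentiable (by simp) x)]
    simp
  have hdf : ∀ x, fderiv ℝ f x (W x) = ∑ i, fderiv ℝ f x (b i) * ⟪b i, W x⟫ := fun x => by
    conv_lhs => rw [← b.sum_repr' (W x), map_sum]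
    simp [mul_comm]
  simp_rw [hdiv, hdf]
  rw [integral_finsetSum _ fun i _ => ?_, integral_finsetSum _ fun i _ => ?_]
  · simp [integral_fderiv_mul_eq_neg hf (hWb _) (hcb _)]
  · exact ((hWb i).continuous.integrable_of_hasCompactSupport (hcb i)).bdd_mul
      (measurable_fderiv_apply_const ℝ f (b i)).aestronglyMeasurable
      (Eventually.of_forall fun x => ((fderiv ℝ f x).le_opNorm _).trans
        (mul_le_mul_of_nonneg_right (norm_fderiv_le_of_lipschitz ℝ hf) (norm_nonneg _)))
  · have hcont := (hWb i).continuous_fderiv (by simp)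
    exact (hf.continuous.mul (hcont.clm_apply continuous_const)).integrable_of_hasCompactSupport
      (((hcb i).fderiv_apply (𝕜 := ℝ) (b i)).mul_left)

theorem tendsto_integral_fderiv_collar {M : Set E} (hM : IsClosed M) (hne : M.Nonempty)
    (hW : ContDiff ℝ 1 W) (hc : HasCompactSupport W) (ht : TangentTo M W) :
    Tendsto (fun n : ℕ => ∫ x, fderiv ℝ (collar M n) x (W x) ∂ν) atTop (𝓝 0) := by
  obtain ⟨L, hL⟩ := hW.lipschitzWith_of_hasCompactSupport hc (by simp)
  rw [← integral_zero E ℝ (μ := ν)]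
  refine tendsto_integral_of_dominated_convergence ((tsupport W).indicator fun _ => (L : ℝ))
    (fun n => ?_) ?_ (fun n => ?_) (Eventually.of_forall fun x => ?_)
  · have h : Measurable fun x => (fderiv ℝ (collar M n) x, W x) :=
      (measurable_fderiv ℝ _).prodMk hW.continuous.measurable
    exact (isBoundedBilinearMap_apply.continuous.measurable.comp h).aestronglyMeasurable
  · exact (integrable_indicator_iff (isClosed_tsupport W).measurableSet).2
      (integrableOn_const hc.isCompact.measure_lt_top.ne)
  · filter_upwards [(lipschitzWith_collar M n).ae_differentiableAt] with x hx
    by_cases hxs : x ∈ tsupport W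
    · rw [indicator_of_mem hxs]
      exact abs_fderiv_collar_le hM hne hL ht hx
    · simp [hxs, image_eq_zero_of_notMem_tsupport hxs]
  · refine tendsto_const_nhds.congr' ?_
    filter_upwards [eventually_fderiv_collar_eq_zero M x] with n hn
    simp [hn]

theorem setIntegral_divergence_eq_zero {M : Set E} (hM : IsClosed M) (hW : ContDiff ℝ 1 W)
    (hc : HasCompactSupport W) (ht : TangentTo M W) : ∫ x in M, divergence W x ∂ν = 0 := by
  rcases M.eq_empty_or_nonempty with rfl | hne
  · simp
  have hdiv := tendsto_integral_collar_mul (ν := ν) hM hne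
    ((continuous_divergence hW).integrable_of_hasCompactSupport (hasCompactSupport_divergence hc))
  simp_rw [integral_mul_divergence_eq_neg (lipschitzWith_collar M _) hW hc] at hdiv
  simpa using tendsto_nhds_unique hdiv (tendsto_integral_fderiv_collar hM hne hW hc ht).neg

end Divergence

end DivergenceTheorem

section Calculus

section PartialDerivatives

variable {E P Q F : Type*} [NormedAddCommGroup E] [NormedSpace ℝ E] [NormedAddCommGroup P]
  [NormedSpace ℝ P] [NormedAddCommGroup Q] [NormedSpace ℝ Q] [NormedAddCommGroup F]
  [NormedSpace ℝ F]

theorem fderiv_prodMk_curve {g : P × Q → F} {k : P → Q} {p : P}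
    (hg : DifferentiableAt ℝ g (p, k p)) (hk : DifferentiableAt ℝ k p) (v : P) :
    fderiv ℝ (fun q => g (q, k q)) p v = fderiv ℝ g (p, k p) (v, fderiv ℝ k p v) :=
  congrArg (· v) (hg.hasFDerivAt.comp p ((hasFDerivAt_id p).prodMk hk.hasFDerivAt)).fderiv

theorem fderiv_prodMk_left {g : P × Q → F} {p : P} {y : Q} (hg : DifferentiableAt ℝ g (p, y))
    (v : P) : fderiv ℝ (fun q => g (q, y)) p v = fderiv ℝ g (p, y) (v, 0) := by
  simpa using fderiv_prodMk_curve hg (differentiableAt_const y) v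

theorem fderiv_prodMk_right {g : P × Q → F} {p : P} {y : Q} (hg : DifferentiableAt ℝ g (p, y))
    (w : Q) : fderiv ℝ (fun z => g (p, z)) y w = fderiv ℝ g (p, y) (0, w) :=
  congrArg (· w) (hg.hasFDerivAt.comp y (hasFDerivAt_prodMk_right p y)).fderiv

theorem deriv_prodMk_left {f : ℝ × ℝ → F} {e t : ℝ} (hf : DifferentiableAt ℝ f (e, t)) :
    deriv (fun r => f (r, t)) e = fderiv ℝ f (e, t) (1, 0) := by
  rw [← fderiv_apply_one_eq_deriv, fderiv_prodMk_left hf]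

theorem deriv_prodMk_right {f : ℝ × ℝ → F} {e t : ℝ} (hf : DifferentiableAt ℝ f (e, t)) :
    deriv (fun r => f (e, r)) t = fderiv ℝ f (e, t) (0, 1) := by
  rw [← fderiv_apply_one_eq_deriv, fderiv_prodMk_right hf]

theorem fderiv_fderiv_apply_comm {f : E → F} (hf : ContDiff ℝ 2 f) (x a b : E) :
    fderiv ℝ (fun y => fderiv ℝ f y a) x b = fderiv ℝ (fun y => fderiv ℝ f y b) x a := by
  have hd : DifferentiableAt ℝ (fderiv ℝ f) x :=
    (hf.fderiv_right (m := 1) le_rfl).differentiable (by simp) x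
  have h : ∀ c, fderiv ℝ (fun y => fderiv ℝ f y c) x = (fderiv ℝ (fderiv ℝ f) x).flip c := by
    intro c
    simp [fderiv_clm_apply hd (differentiableAt_const c)]
  rw [h, h]
  exact (hf.contDiffAt.isSymmSndFDerivAt (by simp)).eq b a

end PartialDerivatives

/-! ### Smooth families of fields -/

section SmoothFamily

variable {M : Set Plane} {P P' F G H : Type*}
  [NormedAddCommGroup P] [NormedSpace ℝ P] [NormedAddCommGroup P'] [NormedSpace ℝ P']
  [NormedAddCommGroup F] [NormedSpace ℝ F] [NormedAddCommGroup G] [NormedSpace ℝ G]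
  [NormedAddCommGroup H] [NormedSpace ℝ H]

theorem smoothFamily_val (a : Smooth M F) : SmoothFamily fun _ : P => val a := by
  obtain ⟨g, hg, e⟩ := a.2
  exact ⟨fun z => g z.2, by fun_prop, fun _ => e⟩

theorem smoothFamily_param {c : P → F} (hc : ContDiff ℝ ∞ c) :
    SmoothFamily fun p (_ : M) => c p :=
  ⟨fun z => c z.1, by fun_prop, fun _ _ => rfl⟩

namespace SmoothFamily

variable {f : P → M → F} {g : P → M → G}

theorem mem_smooth (hf : SmoothFamily f) (p : P) : f p ∈ Smooth M F := by
  obtain ⟨f', hf', e⟩ := hf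
  exact ⟨fun x => f' (p, x), by fun_prop, e p⟩

theorem contDiff (hf : SmoothFamily f) (x : M) : ContDiff ℝ ∞ fun p => f p x := by
  obtain ⟨f', hf', e⟩ := hf
  simp_rw [e]
  fun_prop

theorem differentiable (hf : SmoothFamily f) (x : M) : Differentiable ℝ fun p => f p x :=
  (hf.contDiff x).differentiable (by simp)

theorem continuous (hf : SmoothFamily f) : Continuous fun z : P × M => f z.1 z.2 := by
  obtain ⟨f', hf', e⟩ := hf
  simp_rw [e]
  fun_prop

theorem map (hf : SmoothFamily f) {Φ : F → G} (hΦ : ContDiff ℝ ∞ Φ) :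
    SmoothFamily fun p x => Φ (f p x) := by
  obtain ⟨f', hf', e⟩ := hf
  exact ⟨fun z => Φ (f' z), hΦ.comp hf', fun p x => congrArg Φ (e p x)⟩

theorem prodMk (hf : SmoothFamily f) (hg : SmoothFamily g) :
    SmoothFamily fun p x => (f p x, g p x) := by
  obtain ⟨f', hf', e⟩ := hf
  obtain ⟨g', hg', e'⟩ := hg
  exact ⟨fun z => (f' z, g' z), by fun_prop, fun p x => Prod.ext (e p x) (e' p x)⟩

theorem map₂ (hf : SmoothFamily f) (hg : SmoothFamily g) {Φ : F × G → H} (hΦ : ContDiff ℝ ∞ Φ) :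
    SmoothFamily fun p x => Φ (f p x, g p x) :=
  (hf.prodMk hg).map hΦ

theorem add {f' : P → M → F} (hf : SmoothFamily f) (hf' : SmoothFamily f') :
    SmoothFamily fun p x => f p x + f' p x :=
  hf.map₂ hf' contDiff_add

theorem sub {f' : P → M → F} (hf : SmoothFamily f) (hf' : SmoothFamily f') :
    SmoothFamily fun p x => f p x - f' p x :=
  hf.map₂ hf' (contDiff_fst.sub contDiff_snd)

theorem neg (hf : SmoothFamily f) : SmoothFamily fun p x => - f p x :=
  hf.map contDiff_neg

theorem smul {k : P → M → ℝ} (hk : SmoothFamily k) (hf : SmoothFamily f) :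
    SmoothFamily fun p x => k p x • f p x :=
  hk.map₂ hf contDiff_smul

theorem mul {k l : P → M → ℝ} (hk : SmoothFamily k) (hl : SmoothFamily l) :
    SmoothFamily fun p x => k p x * l p x :=
  hk.smul hl

theorem clm_apply {A : P → M → F →L[ℝ] G} (hA : SmoothFamily A) (hf : SmoothFamily f) :
    SmoothFamily fun p x => A p x (f p x) :=
  hA.map₂ hf (contDiff_fst.clm_apply contDiff_snd)

theorem clm_comp {A : P → M → G →L[ℝ] H} {B : P → M → F →L[ℝ] G} (hA : SmoothFamily A)
    (hB : SmoothFamily B) : SmoothFamily fun p x => (A p x).comp (B p x) :=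
  hA.map₂ hB (contDiff_fst.clm_comp contDiff_snd)

theorem comp_param (hf : SmoothFamily f) {c : P' → P} (hc : ContDiff ℝ ∞ c) :
    SmoothFamily fun p => f (c p) := by
  obtain ⟨f', hf', e⟩ := hf
  exact ⟨fun z => f' (c z.1, z.2), by fun_prop, fun p => e (c p)⟩

theorem comp (hf : SmoothFamily f) {k : P → M → M} (hk : SmoothFamily fun p x => (k p x : Plane)) :
    SmoothFamily fun p x => f p (k p x) := by
  obtain ⟨f', hf', e⟩ := hf
  obtain ⟨k', hk', e'⟩ := hk
  exact ⟨fun z => f' (z.1, k' z), by fun_prop, fun p x => (e p (k p x)).trans (by simp only [e'])⟩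

theorem fderiv (hf : SmoothFamily f) : SmoothFamily fun p x => fderiv ℝ (fun q => f q x) p := by
  obtain ⟨f', hf', e⟩ := hf
  refine ⟨fun z => _root_.fderiv ℝ (fun q => f' (q, z.2)) z.1, ?_, fun p x => by simp only [e]⟩
  exact ContDiff.fderiv (f := fun z q => f' (q, z.2)) (n := ∞) (by fun_prop) contDiff_fst le_rfl

theorem fderiv_apply (hf : SmoothFamily f) (a : P) :
    SmoothFamily fun p x => _root_.fderiv ℝ (fun q => f q x) p a :=
  hf.fderiv.clm_apply (smoothFamily_param contDiff_const)

theorem deriv {f : ℝ → M → F} (hf : SmoothFamily f) :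
    SmoothFamily fun t x => deriv (fun τ => f τ x) t :=
  hf.fderiv_apply 1

end SmoothFamily

end SmoothFamily

/-! ### The derivative of a smooth field -/

section Derivative

variable {M : Set Plane} {F G H : Type*} [NormedAddCommGroup F] [NormedSpace ℝ F]
  [NormedAddCommGroup G] [NormedSpace ℝ G] [NormedAddCommGroup H] [NormedSpace ℝ H]

@[fun_prop]
theorem continuous_val (a : Smooth M F) : Continuous (val a) := by
  obtain ⟨g, hg, e⟩ := a.2
  rw [show val a = fun x : M => g x from funext e]
  fun_prop

@[fun_prop]
theorem continuous_d (a : Smooth M F) : Continuous (d a) :=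
  (a.2.choose_spec.1.continuous_fderiv (by simp)).comp continuous_subtype_val

@[fun_prop]
theorem continuous_vval (u : Vec M) : Continuous (vval u) := continuous_val _

@[fun_prop]
theorem continuous_dv (u : Vec M) : Continuous (dv u) := continuous_d _

@[fun_prop]
theorem continuous_div (u : Vec M) : Continuous (div u) := by
  unfold div
  fun_prop

theorem div_eq_trace (u : Vec M) (x : M) : div u x = LinearMap.trace ℝ Plane (dv u x) := by
  rw [LinearMap.trace_eq_sum_inner _ (EuclideanSpace.basisFun (Fin 2) ℝ)]
  simp [div, EuclideanSpace.inner_single_left]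

/-- The pointwise product of two smooth fields with respect to a bilinear map. -/
def Smooth.bilin (B : F →L[ℝ] G →L[ℝ] H) (a : Smooth M F) (b : Smooth M G) : Smooth M H :=
  ⟨fun x => B (val a x) (val b x), by
    obtain ⟨g, hg, e⟩ := a.2
    obtain ⟨k, hk, e'⟩ := b.2
    exact ⟨fun x => B (g x) (k x), by fun_prop, fun x => by simp only [val, e, e']⟩⟩

theorem val_bilin (B : F →L[ℝ] G →L[ℝ] H) (a : Smooth M F) (b : Smooth M G) (x : M) :
    val (Smooth.bilin B a b) x = B (val a x) (val b x) := rfl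

variable (hM' : M ⊆ closure (interior M))

include hM'

theorem d_bilin (B : F →L[ℝ] G →L[ℝ] H) (a : Smooth M F) (b : Smooth M G) (x : M) (w : Plane) :
    d (Smooth.bilin B a b) x w = B (d a x w) (val b x) + B (val a x) (d b x w) := by
  obtain ⟨g, hg, e⟩ := a.2
  obtain ⟨k, hk, e'⟩ := b.2
  have hgk : ContDiff ℝ ∞ fun y => B (g y) (k y) := by fun_prop
  rw [d_eq hM' _ _ hgk (fun y => by rw [val_bilin, val, val, e, e']) x, d_eq hM' a g hg e,
    d_eq hM' b k hk e', val, val, e, e',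
    B.fderiv_of_bilinear (hg.differentiable (by simp) x) (hk.differentiable (by simp) x)]
  simp [add_comm]

theorem d_eq_comp {a c : Smooth M F} {φ : M → M} (k : Smooth M Plane)
    (hk : ∀ x, val k x = φ x) (hc : ∀ x, val c x = val a (φ x)) (x : M) :
    d c x = (d a (φ x)).comp (d k x) := by
  obtain ⟨g, hg, e⟩ := a.2
  obtain ⟨l, hl, e'⟩ := k.2
  have hlx : ∀ y : M, l y = φ y := fun y => (e' y).symm.trans (hk y)
  rw [d_eq hM' c (fun y => g (l y)) (by fun_prop) (fun y => by rw [hc, hlx]; exact e _),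
    d_eq hM' a g hg e, d_eq hM' k l hl e', ← hlx]
  exact fderiv_comp _ (hg.differentiable (by simp) _) (hl.differentiable (by simp) _)

theorem d_eq_zero_of_eventually {a : Smooth M F} {x : M}
    (h : ∀ᶠ y in nhds (x : Plane), ∀ hy : y ∈ M, val a ⟨y, hy⟩ = 0) : d a x = 0 := by
  obtain ⟨g, hg, e⟩ := a.2
  rw [d_eq hM' a g hg e]
  obtain ⟨U, hUsub, hU, hxU⟩ := eventually_nhds_iff.1 h
  have hclosed : IsClosed {y | fderiv ℝ g y = 0} :=
    isClosed_eq (hg.continuous_fderiv (by simp)) continuous_const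
  have hzero : U ∩ interior M ⊆ {y | fderiv ℝ g y = 0} := fun y hy => by
    have hloc : g =ᶠ[nhds y] fun _ => 0 := by
      filter_upwards [(hU.inter isOpen_interior).mem_nhds hy] with z hz
      exact (e ⟨z, interior_subset hz.2⟩).symm.trans (hUsub z hz.1 _)
    rw [mem_ofPred, hloc.fderiv_eq, fderiv_const_apply]
  exact closure_minimal hzero hclosed (hU.inter_closure ⟨hxU, hM' x.2⟩)

end Derivative

/-! ### Derivatives of families along their parameters -/

section Families

variable {M : Set Plane} {P F : Type*} [NormedAddCommGroup P] [NormedSpace ℝ P]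
  [NormedAddCommGroup F] [NormedSpace ℝ F] (hM' : M ⊆ closure (interior M)) {a : P → Smooth M F}
  (ha : SmoothFamily fun p => val (a p))

include hM' ha

theorem SmoothFamily.d : SmoothFamily fun p => d (a p) := by
  obtain ⟨g, hg, e⟩ := ha
  refine ⟨fun z => _root_.fderiv ℝ (fun y => g (z.1, y)) z.2, ?_, fun p x => ?_⟩
  · exact ContDiff.fderiv (f := fun z y => g (z.1, y)) (n := ∞) (by fun_prop) contDiff_snd le_rfl
  · exact d_eq hM' (a p) (fun y => g (p, y)) (by fun_prop) (e p) x

theorem SmoothFamily.fderiv_val_curve {k : P → M} {p : P}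
    (hk : DifferentiableAt ℝ (fun q => (k q : Plane)) p) (v : P) :
    _root_.fderiv ℝ (fun q => val (a q) (k q)) p v =
      _root_.fderiv ℝ (fun q => val (a q) (k p)) p v +
        VSM.d (a p) (k p) (_root_.fderiv ℝ (fun q => (k q : Plane)) p v) := by
  obtain ⟨g, hg, e⟩ := ha
  have hg' : DifferentiableAt ℝ g (p, (k p : Plane)) := hg.differentiable (by simp) _
  simp only [e]
  rw [d_eq hM' (a p) (fun y => g (p, y)) (by fun_prop) (e p), fderiv_prodMk_curve hg' hk,
    fderiv_prodMk_left hg', fderiv_prodMk_right hg', ← map_add]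
  simp

theorem SmoothFamily.fderiv_d {p v : P} {b : Smooth M F}
    (hb : ∀ x, val b x = _root_.fderiv ℝ (fun q => val (a q) x) p v) (x : M) :
    _root_.fderiv ℝ (fun q => VSM.d (a q) x) p v = VSM.d b x := by
  have hd := (ha.d hM').differentiable x p
  obtain ⟨g, hg, e⟩ := ha
  have hg' : Differentiable ℝ g := hg.differentiable (by simp)
  have hgd : ∀ c, ContDiff ℝ ∞ fun z => _root_.fderiv ℝ g z c := fun c =>
    (hg.fderiv_right le_rfl).clm_apply contDiff_const
  have hgd' : ∀ c, Differentiable ℝ fun z => _root_.fderiv ℝ g z c := fun c =>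
    (hgd c).differentiable (by simp)
  ext w : 1
  calc _root_.fderiv ℝ (fun q => VSM.d (a q) x) p v w
      = _root_.fderiv ℝ (fun q => VSM.d (a q) x w) p v := by
        simp [fderiv_clm_apply hd (differentiableAt_const w)]
    _ = _root_.fderiv ℝ (fun q => _root_.fderiv ℝ g (q, (x : Plane)) (0, w)) p v := by
        congr 2 with q
        rw [d_eq hM' (a q) (fun y => g (q, y)) (by fun_prop) (e q), fderiv_prodMk_right (hg' _)]
    _ = _root_.fderiv ℝ (fun z => _root_.fderiv ℝ g z (0, w)) (p, (x : Plane)) (v, 0) :=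
        fderiv_prodMk_left (hgd' _ _) v
    _ = _root_.fderiv ℝ (fun z => _root_.fderiv ℝ g z (v, 0)) (p, (x : Plane)) (0, w) :=
        fderiv_fderiv_apply_comm (hg.of_le (by norm_cast)) _ _ _
    _ = _root_.fderiv ℝ (fun y => _root_.fderiv ℝ g (p, y) (v, 0)) x w :=
        (fderiv_prodMk_right (hgd' _ _) w).symm
    _ = VSM.d b x w := by
        rw [d_eq hM' b _ ((hgd (v, 0)).comp (contDiff_prodMk_right p)) fun y => ?_]
        · rfl
        · rw [hb]
          simp only [e]
          exact fderiv_prodMk_left (hg' _) v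

end Families

end Calculus

/-! ### Duality -/

section Duality

variable {M : Set Plane} {F : Type*} [NormedAddCommGroup F] [NormedSpace ℝ F]

theorem Smooth.exists_extension_of_bddSupp {a : Smooth M F} {R : ℝ}
    (h : ∀ x : M, R < ‖(x : Plane)‖ → val a x = 0) :
    ∃ g : Plane → F, ContDiff ℝ ∞ g ∧ HasCompactSupport g ∧ ∀ x : M, val a x = g x := by
  obtain ⟨g, hg, e⟩ := a.2
  let χ : ContDiffBump (0 : Plane) := ⟨|R| + 1, |R| + 2, by positivity, by linarith⟩
  refine ⟨fun x => χ x • g x, χ.contDiff.smul hg, χ.hasCompactSupport.smul_right, fun x => ?_⟩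
  rcases le_or_gt ‖(x : Plane)‖ R with hx | hx
  · have hχ : χ (x : Plane) = 1 := χ.one_of_mem_closedBall <| by
      rw [mem_closedBall_zero_iff]
      exact hx.trans ((le_abs_self R).trans (by simp [χ]))
    simp only [hχ, one_smul, val, e]
  · have hg0 : g x = 0 := (e x).symm.trans (h x hx)
    simp only [h x hx, hg0, smul_zero]

theorem isFiniteMeasureOnCompacts_area (hM : IsClosed M) :
    IsFiniteMeasureOnCompacts (area M) :=
  .comap' volume continuous_subtype_val (.subtype_coe hM.measurableSet)

theorem integrable_of_bddSupp {E : Type*} [NormedAddCommGroup E] (hM : IsClosed M) {f : M → E}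
    (hf : Continuous f) {R : ℝ} (h : ∀ x : M, R < ‖(x : Plane)‖ → f x = 0) :
    Integrable f (area M) := by
  have := isFiniteMeasureOnCompacts_area hM
  refine hf.integrable_of_hasCompactSupport (HasCompactSupport.intro
    (hM.isClosedEmbedding_subtypeVal.isCompact_preimage (isCompact_closedBall 0 R)) fun x hx => ?_)
  exact h x (by simpa using hx)

/-- The product of a function and a vector field. -/
def Vec.smul (k : Fun M) (u : Vec M) : Vec M :=
  ⟨Smooth.bilin (ContinuousLinearMap.lsmul ℝ ℝ) k u, fun p y h => by
    change inner ℝ (val k p • vval u p) (y - p) = 0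
    rw [inner_smul_left, show inner ℝ (vval u p) (y - p) = 0 from u.2 p y h, mul_zero]⟩

theorem vval_smul (k : Fun M) (u : Vec M) (x : M) :
    vval (Vec.smul k u) x = val k x • vval u x := rfl

theorem bddSupp_smul_of_left {k : Fun M} {R : ℝ} (h : ∀ x : M, R < ‖(x : Plane)‖ → val k x = 0)
    (u : Vec M) : BddSupp (Vec.smul k u) :=
  ⟨R, fun x hx => by rw [vval_smul, h x hx, zero_smul]⟩

theorem bddSupp_smul_of_right (k : Fun M) {v : Vec M} {R : ℝ}
    (h : ∀ x : M, R < ‖(x : Plane)‖ → vval v x = 0) : BddSupp (Vec.smul k v) :=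
  ⟨R, fun x hx => by rw [vval_smul, h x hx, smul_zero]⟩

theorem val_contract_eq_zero (m : OneFormDen M) {v : Vec M} {x : M} (h : vval v x = 0) :
    val (Smooth.bilin (.id ℝ _) m (v : Smooth M Plane)) x = 0 := by
  rw [val_bilin, show val v.1 x = 0 from h, map_zero]

theorem pairVec_diamondFun (v : Vec M) (b : Den M) (a : Fun M) :
    - pairVec (diamondFun b a) (vval v) = pairFun (lieFun v a) (val b) := by
  simp [pairVec, pairFun, diamondFun, lieFun, integral_neg, mul_comm]

variable (hM' : M ⊆ closure (interior M))

include hM'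

theorem div_smul (k : Fun M) (u : Vec M) (x : M) : div (Vec.smul k u) x = lieDen u k x := by
  have hd : (dv (Vec.smul k u) x : Plane →ₗ[ℝ] Plane) =
      (d k x : Plane →ₗ[ℝ] ℝ).smulRight (vval u x) + val k x • (dv u x : Plane →ₗ[ℝ] Plane) := by
    ext1 w
    exact d_bilin hM' (ContinuousLinearMap.lsmul ℝ ℝ) k u.1 x w
  rw [div_eq_trace, hd, map_add, map_smul, LinearMap.trace_smulRight, lieDen, div_eq_trace]
  rfl

theorem lieDen_bilin {G : Type*} [NormedAddCommGroup G] [NormedSpace ℝ G]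
    (B : F →L[ℝ] G →L[ℝ] ℝ) (u : Vec M) (a : Smooth M F) (b : Smooth M G) (x : M) :
    lieDen u (Smooth.bilin B a b) x = B (d a x (vval u x)) (val b x) +
      B (val a x) (d b x (vval u x)) + B (val a x) (val b x) * div u x := by
  rw [lieDen, d_bilin hM', val_bilin]

theorem lieDen_mul (u : Vec M) (n : Den M) (a : Fun M) (x : M) :
    lieDen u (Smooth.bilin (.mul ℝ ℝ) n a) x =
      lieDen u n x * val a x + val n x * lieFun u a x := by
  rw [lieDen_bilin hM']
  simp only [ContinuousLinearMap.mul_apply', lieDen, lieFun]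
  ring

theorem lieDen_contract (u v : Vec M) (m : OneFormDen M) (x : M) :
    lieDen u (Smooth.bilin (.id ℝ _) m (v : Smooth M Plane)) x =
      adStar u m x (vval v x) - val m x (adVec u v x) := by
  rw [lieDen_bilin hM']
  change d m x (vval u x) (vval v x) + val m x (dv v x (vval u x)) +
    val m x (vval v x) * div u x = _
  simp only [adStar, adVec, bracket, add_apply, smul_apply, ContinuousLinearMap.comp_apply,
    map_neg, map_sub, smul_eq_mul]
  ring

theorem dv_eq_zero_of_bddSupp {w : Vec M} {R : ℝ} (h : ∀ x : M, R < ‖(x : Plane)‖ → vval w x = 0)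
    {x : M} (hx : R < ‖(x : Plane)‖) : dv w x = 0 :=
  d_eq_zero_of_eventually hM' <| by
    filter_upwards [(isOpen_lt continuous_const continuous_norm).mem_nhds hx] with y hy hyM
    exact h ⟨y, hyM⟩ hy

variable (hM : IsClosed M)

include hM

theorem integral_div_eq_zero {w : Vec M} (hw : BddSupp w) : ∫ x, div w x ∂(area M) = 0 := by
  obtain ⟨R, hR⟩ := hw
  obtain ⟨W, hW, hWc, e⟩ := Smooth.exists_extension_of_bddSupp (a := (w : Smooth M Plane)) hR
  have ht : TangentTo M W := fun p hp y hy => by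
    rw [← e ⟨p, hp⟩]
    exact w.2 ⟨p, hp⟩ y hy
  have hdiv : ∀ x : M, div w x = divergence W x := fun x => by
    rw [div_eq_trace, dv, d_eq hM' _ W hW e, divergence]
  simp_rw [hdiv]
  exact (integral_subtype_comap hM.measurableSet (divergence W)).trans
    (setIntegral_divergence_eq_zero hM (hW.of_le (by simp)) hWc ht)

theorem integrable_lieDen {u : Vec M} {k : Fun M} (h : BddSupp (Vec.smul k u)) :
    Integrable (lieDen u k) (area M) := by
  obtain ⟨R, hR⟩ := h
  refine integrable_of_bddSupp hM (by unfold lieDen; fun_prop) (R := R) fun x hx => ?_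
  rw [← div_smul hM', div_eq_trace, dv_eq_zero_of_bddSupp hM' hR hx]
  exact map_zero _

theorem integral_lieDen_eq_zero {u : Vec M} {k : Fun M} (h : BddSupp (Vec.smul k u)) :
    ∫ x, lieDen u k x ∂(area M) = 0 := by
  simp_rw [← div_smul hM']
  exact integral_div_eq_zero hM' hM h

theorem integral_eq_of_lieDen_eq_sub {u : Vec M} {k : Fun M} (hku : BddSupp (Vec.smul k u))
    {f f' : M → ℝ} (hf : Integrable f (area M)) (h : ∀ x, lieDen u k x = f x - f' x) :
    ∫ x, f x ∂(area M) = ∫ x, f' x ∂(area M) := by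
  have hf' : f' = fun x => f x - lieDen u k x := funext fun x => by rw [h, sub_sub_cancel]
  rw [hf', integral_sub hf (integrable_lieDen hM' hM hku), integral_lieDen_eq_zero hM' hM hku,
    sub_zero]

theorem pairVec_adStar {u v : Vec M} (m : OneFormDen M) (hv : BddSupp v) :
    pairVec (adStar u m) (vval v) = pairVec (val m) (adVec u v) := by
  obtain ⟨R, hR⟩ := hv
  have hf : Integrable (fun x => adStar u m x (vval v x)) (area M) :=
    integrable_of_bddSupp hM (by unfold adStar; fun_prop) (R := R) fun x hx => by
      rw [hR x hx, map_zero]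
  exact integral_eq_of_lieDen_eq_sub hM' hM (bddSupp_smul_of_left
    (fun x hx => val_contract_eq_zero m (hR x hx)) u) hf
    (lieDen_contract hM' u v m)

theorem pairVec_diamondDen {v : Vec M} (b : Fun M) (D : Den M) (hv : BddSupp v) :
    - pairVec (diamondDen b D) (vval v) = pairFun (lieDen v D) (val b) := by
  obtain ⟨R, hR⟩ := hv
  have hf : Integrable (fun x => diamondDen b D x (vval v x)) (area M) :=
    integrable_of_bddSupp hM (by unfold diamondDen; fun_prop) (R := R) fun x hx => by
      rw [hR x hx, map_zero]
  rw [neg_eq_iff_eq_neg, pairFun, ← integral_neg]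
  refine integral_eq_of_lieDen_eq_sub hM' hM (k := Smooth.bilin (.mul ℝ ℝ) D b)
    (bddSupp_smul_of_right _ hR) hf fun x => ?_
  rw [lieDen_mul hM', sub_neg_eq_add, add_comm]
  rfl

end Duality

/-! ### Constrained variations -/

section Determinant

variable {E : Type*} [NormedAddCommGroup E] [NormedSpace ℝ E] [FiniteDimensional ℝ E]

theorem contDiff_det : ContDiff ℝ ∞ fun A : E →L[ℝ] E => A.det := by
  have b := Module.finBasis ℝ E
  have hentry : ∀ i j, ContDiff ℝ ∞ fun A : E →L[ℝ] E => b.repr (A (b j)) i := fun i j =>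
    ((b.coord i).toContinuousLinearMap.comp (.apply ℝ E (b j))).contDiff
  simp_rw [ContinuousLinearMap.det, ← LinearMap.det_toMatrix b, Matrix.det_apply,
    LinearMap.toMatrix_apply]
  exact ContDiff.sum fun σ _ => (contDiff_prod fun i _ => hentry _ _).const_smul _

theorem fderiv_det_id (B : E →L[ℝ] E) :
    fderiv ℝ (fun A : E →L[ℝ] E => A.det) (.id ℝ E) B = LinearMap.trace ℝ E B := by
  have b := Module.finBasis ℝ E
  let m := LinearMap.toMatrix b b B
  let p : Polynomial ℝ := (1 + (Polynomial.X : Polynomial ℝ) • m.map Polynomial.C).det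
  have hp : (fun r : ℝ => (.id ℝ E + r • B : E →L[ℝ] E).det) = fun r => p.eval r := by
    ext r
    rw [ContinuousLinearMap.det, ← LinearMap.det_toMatrix b, _root_.eval_det]
    congr 1
    ext i j
    simp [m, LinearMap.toMatrix_apply, Matrix.one_apply, Finsupp.single_apply, eq_comm,
      mul_comm]
  have hline : lineDeriv ℝ (fun A : E →L[ℝ] E => A.det) (.id ℝ E) B = m.trace := by
    rw [lineDeriv, hp, Polynomial.deriv, Matrix.derivative_det_one_add_X_smul]
  rw [← (contDiff_det.differentiable (by simp) _).lineDeriv_eq_fderiv, hline]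
  exact (LinearMap.trace_eq_matrix_trace ℝ b B).symm

/-- Jacobi's formula. -/
theorem fderiv_det_comp (A B : E →L[ℝ] E) :
    fderiv ℝ (fun A : E →L[ℝ] E => A.det) A (B.comp A) = LinearMap.trace ℝ E B * A.det := by
  have hmul : (fun C : E →L[ℝ] E => C.det * A.det) = fun C => (C.comp A).det := by
    ext C
    exact (LinearMap.det_comp _ _).symm
  have hd : Differentiable ℝ fun A : E →L[ℝ] E => A.det := contDiff_det.differentiable (by simp)
  have hcomp : HasFDerivAt (fun C : E →L[ℝ] E => C.comp A)
      ((ContinuousLinearMap.compL ℝ E E E).flip A) (.id ℝ E) :=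
    ((ContinuousLinearMap.compL ℝ E E E).flip A).hasFDerivAt
  have hleft := (hd ((ContinuousLinearMap.id ℝ E).comp A)).hasFDerivAt.comp
    (ContinuousLinearMap.id ℝ E) hcomp
  have hright := (hd (.id ℝ E)).hasFDerivAt.mul_const A.det
  rw [Function.comp_def, ← hmul] at hleft
  have h := congrArg (· B) (hleft.unique hright)
  simp only [ContinuousLinearMap.id_comp, ContinuousLinearMap.comp_apply, smul_apply, smul_eq_mul,
    ContinuousLinearMap.flip_apply, ContinuousLinearMap.compL_apply, fderiv_det_id] at h
  rw [h, mul_comm]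

end Determinant

theorem inner_fderiv_sub_eq_zero {E P : Type*} [NormedAddCommGroup E] [InnerProductSpace ℝ E]
    [NormedAddCommGroup P] [NormedSpace ℝ P] {M : Set E} {γ : P → E} {p : P}
    (hγ : DifferentiableAt ℝ γ p) (hM : ∀ᶠ q in nhds p, γ q ∈ M) {y : E}
    (hy : ∀ z ∈ M, dist y (γ p) ≤ dist y z) (a : P) :
    inner ℝ (fderiv ℝ γ p a) (y - γ p) = 0 := by
  have hmin : IsLocalMin (fun q => ‖y - γ q‖ ^ 2) p := hM.mono fun q hq => by
    simpa only [dist_eq_norm] using pow_le_pow_left₀ dist_nonneg (hy (γ q) hq) 2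
  have h := congrArg (· a) (hmin.hasFDerivAt_eq_zero (hγ.hasFDerivAt.const_sub y).norm_sq)
  rw [real_inner_comm, inner_sub_left, sub_eq_zero, eq_comm, ← sub_eq_zero]
  simpa using h

namespace SliceGroup

variable {M : Set Plane} (hM' : M ⊆ closure (interior M))

include hM'

theorem dφ_mul (g h : SliceGroup M) (x : M) :
    (g * h).dφ x = (g.dφ (h.φ x)).comp (h.dφ x) :=
  d_eq_comp hM' (a := ⟨_, g.smooth_φ⟩) ⟨_, h.smooth_φ⟩ (fun _ => rfl) (fun _ => rfl) x

theorem dφ_one (x : M) : (1 : SliceGroup M).dφ x = .id ℝ Plane :=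
  (d_eq hM' _ id contDiff_id (fun _ => rfl) x).trans fderiv_id

theorem det_dφ_inv_mul_det_dφ (g : SliceGroup M) (x : M) :
    (g⁻¹.dφ (g.φ x)).det * (g.dφ x).det = 1 := by
  have h := congrArg ContinuousLinearMap.det (dφ_mul hM' g⁻¹ g x)
  rw [inv_mul_cancel, dφ_one hM'] at h
  simpa [ContinuousLinearMap.det] using h.symm

end SliceGroup

section GroupFamily

variable {M : Set Plane} {P F : Type*} [NormedAddCommGroup P] [NormedSpace ℝ P]
  [NormedAddCommGroup F] [NormedSpace ℝ F] {g : P → SliceGroup M} (hg : SmoothGroupFamily g)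

/-- The push-forward `φ_* (∂_a k)` along the diffeomorphisms of a family in `S` of the derivative
of a family of fields in the direction `a` of the parameters. -/
def pushDeriv {k : P → M → F} (hk : SmoothFamily k) (a p : P) : Smooth M F :=
  ⟨fun y => fderiv ℝ (fun q => k q ((g p).φ.symm y)) p a,
    ((hk.fderiv_apply a).comp hg.2.1).mem_smooth p⟩

theorem smoothFamily_pushDeriv {k : P → M → F} (hk : SmoothFamily k) (a : P) :
    SmoothFamily fun p => val (pushDeriv hg hk a p) :=
  (hk.fderiv_apply a).comp hg.2.1

theorem val_pushDeriv {k : P → M → F} (hk : SmoothFamily k) (a p : P) (x : M) :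
    val (pushDeriv hg hk a p) ((g p).φ x) = fderiv ℝ (fun q => k q x) p a := by
  simp [val, pushDeriv]

/-- The Eulerian velocity `(∂_a φ) φ⁻¹` of a family in `S` in the direction `a` of the
parameters. -/
def eulerianVelocity (a p : P) : Vec M :=
  ⟨pushDeriv hg hg.1 a p, fun y w hw => by
    have h := inner_fderiv_sub_eq_zero (M := M) (hg.1.differentiable ((g p).φ.symm y) p)
      (.of_forall fun q => Subtype.coe_prop _) (y := w) (by simpa using hw) a
    rwa [Equiv.apply_symm_apply] at h⟩

theorem vval_eulerianVelocity (a p : P) (x : M) :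
    vval (eulerianVelocity hg a p) ((g p).φ x) = fderiv ℝ (fun q => ((g q).φ x : Plane)) p a :=
  val_pushDeriv hg hg.1 a p x

include hg in
theorem SmoothGroupFamily.inv : SmoothGroupFamily fun p => (g p)⁻¹ :=
  ⟨hg.2.1, hg.1, (hg.2.2.comp hg.2.1).neg⟩

include hg in
theorem smoothFamily_advectedScalar (s : ℝ) (θ₀ : Fun M) :
    SmoothFamily fun p y => val θ₀ ((g p).φ.symm y) + SliceGroup.cocycle s (g p)⁻¹ y :=
  ((smoothFamily_val θ₀).comp hg.2.1).add
    ((smoothFamily_param contDiff_const).mul hg.inv.2.2)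

variable (hM' : M ⊆ closure (interior M))

include hg hM'

theorem fderiv_val_flow {k : P → Smooth M F} (hk : SmoothFamily fun p => val (k p)) (a p : P)
    (x : M) : fderiv ℝ (fun q => val (k q) ((g q).φ x)) p a =
      fderiv ℝ (fun q => val (k q) ((g p).φ x)) p a +
        d (k p) ((g p).φ x) (vval (eulerianVelocity hg a p) ((g p).φ x)) := by
  rw [vval_eulerianVelocity]
  exact hk.fderiv_val_curve hM' (hg.1.differentiable x p) a

theorem fderiv_pushDeriv_comm {k : P → M → F} (hk : SmoothFamily k) (a b p : P) (y : M) :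
    fderiv ℝ (fun q => val (pushDeriv hg hk b q) y) p a +
        d (pushDeriv hg hk b p) y (vval (eulerianVelocity hg a p) y) =
      fderiv ℝ (fun q => val (pushDeriv hg hk a q) y) p b +
        d (pushDeriv hg hk a p) y (vval (eulerianVelocity hg b p) y) := by
  obtain ⟨x, rfl⟩ := (g p).φ.surjective y
  rw [← fderiv_val_flow hg hM' (smoothFamily_pushDeriv hg hk b),
    ← fderiv_val_flow hg hM' (smoothFamily_pushDeriv hg hk a)]
  simp only [val_pushDeriv]
  exact fderiv_fderiv_apply_comm ((hk.contDiff x).of_le (by norm_cast)) p b a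

theorem fderiv_dφ (a p : P) (x : M) : fderiv ℝ (fun q => (g q).dφ x) p a =
    (dv (eulerianVelocity hg a p) ((g p).φ x)).comp ((g p).dφ x) := by
  let b : Smooth M Plane := ⟨_, (hg.1.fderiv_apply a).mem_smooth p⟩
  have hb : fderiv ℝ (fun q => (g q).dφ x) p a = d b x :=
    SmoothFamily.fderiv_d hM' (a := fun q => ⟨_, (g q).smooth_φ⟩) hg.1 (fun _ => rfl) x
  rw [hb]
  exact d_eq_comp hM' (a := (eulerianVelocity hg a p : Smooth M Plane)) (c := b) (φ := (g p).φ)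
    ⟨_, (g p).smooth_φ⟩ (fun _ => rfl)
    (fun x => (vval_eulerianVelocity hg a p x).symm) x

theorem smoothFamily_dφ : SmoothFamily fun p => (g p).dφ :=
  SmoothFamily.d hM' (a := fun p => ⟨_, (g p).smooth_φ⟩) hg.1

theorem fderiv_det_dφ (a p : P) (x : M) : fderiv ℝ (fun q => ((g q).dφ x).det) p a =
    div (eulerianVelocity hg a p) ((g p).φ x) * ((g p).dφ x).det := by
  have hdet := contDiff_det.differentiable (by simp) ((g p).dφ x)
  have h := hdet.hasFDerivAt.comp p ((smoothFamily_dφ hg hM').differentiable x p).hasFDerivAt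
  rw [show (fun q => ((g q).dφ x).det) = (fun A => A.det) ∘ fun q => (g q).dφ x from rfl, h.fderiv,
    ContinuousLinearMap.comp_apply, fderiv_dφ hg hM', fderiv_det_comp, div_eq_trace]

theorem fderiv_density {D : P → Den M} (hD : SmoothFamily fun p => val (D p)) {D₀ : M → ℝ}
    (h : ∀ p x, val (D p) ((g p).φ x) * ((g p).dφ x).det = D₀ x) (a p : P) (y : M) :
    fderiv ℝ (fun q => val (D q) y) p a = - lieDen (eulerianVelocity hg a p) (D p) y := by
  obtain ⟨x, rfl⟩ := (g p).φ.surjective y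
  have hdet : ((g p).dφ x).det ≠ 0 :=
    right_ne_zero_of_mul_eq_one ((g p).det_dφ_inv_mul_det_dφ hM' x)
  have hdD := (hD.comp hg.1).differentiable x p
  have hddet := ((smoothFamily_dφ hg hM').map contDiff_det).differentiable x p
  have hconst : fderiv ℝ (fun q => val (D q) ((g q).φ x) * ((g q).dφ x).det) p a = 0 := by
    simp [h]
  rw [fderiv_fun_mul hdD hddet] at hconst
  simp only [add_apply, smul_apply, smul_eq_mul, fderiv_det_dφ hg hM',
    fderiv_val_flow hg hM' hD] at hconst
  rw [lieDen]
  apply mul_right_cancel₀ hdet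
  linear_combination hconst

theorem fderiv_scalar {θ : P → Fun M} (hθ : SmoothFamily fun p => val (θ p)) {θ₀ : M → ℝ} {s : ℝ}
    (h : ∀ p x, val (θ p) ((g p).φ x) = θ₀ x - s * (g p).v x) (a p : P) (y : M) :
    fderiv ℝ (fun q => val (θ q) y) p a = - lieFun (eulerianVelocity hg a p) (θ p) y -
      s * val (pushDeriv hg hg.2.2 a p) y := by
  obtain ⟨x, rfl⟩ := (g p).φ.surjective y
  have hflow := fderiv_val_flow hg hM' hθ a p x
  have hv : DifferentiableAt ℝ (fun q => (g q).v x) p := hg.2.2.differentiable x p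
  simp only [h] at hflow
  rw [fderiv_const_sub, fderiv_const_mul hv] at hflow
  rw [lieFun, val_pushDeriv]
  simp only [neg_apply, smul_apply, smul_eq_mul] at hflow
  linear_combination -hflow

theorem smoothFamily_advectedDensity (D₀ : Den M) :
    SmoothFamily fun p y => val D₀ ((g p).φ.symm y) * ((g p)⁻¹.dφ y).det :=
  ((smoothFamily_val D₀).comp hg.2.1).mul ((smoothFamily_dφ hg.inv hM').map contDiff_det)

/-- The state induced by a family in `S` with initial data `D₀`, `ϑ₀`, where the direction `a` of
the parameters is time: `(u_S, u_T) = (φ̇ φ⁻¹, φ_* v̇)`, `D d²x = φ_* (D₀ d²x)` and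
`ϑ_s = φ_* ϑ₀ + c((φ, v)⁻¹)`. -/
def inducedState (s : ℝ) (D₀ : Den M) (θ₀ : Fun M) (a p : P) : State M where
  u := (eulerianVelocity hg a p, pushDeriv hg hg.2.2 a p)
  D := ⟨_, (smoothFamily_advectedDensity hg hM' D₀).mem_smooth p⟩
  θ := ⟨_, (smoothFamily_advectedScalar hg s θ₀).mem_smooth p⟩

theorem smoothStateFamily_inducedState (s : ℝ) (D₀ : Den M) (θ₀ : Fun M) (a : P) :
    SmoothStateFamily (inducedState hg hM' s D₀ θ₀ a) :=
  ⟨smoothFamily_pushDeriv hg hg.1 a, smoothFamily_pushDeriv hg hg.2.2 a,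
    smoothFamily_advectedDensity hg hM' D₀, smoothFamily_advectedScalar hg s θ₀⟩

theorem val_inducedState_D_mul_det (s : ℝ) (D₀ : Den M) (θ₀ : Fun M) (a p : P) (x : M) :
    val (inducedState hg hM' s D₀ θ₀ a p).D ((g p).φ x) * ((g p).dφ x).det = val D₀ x := by
  change val D₀ ((g p).φ.symm ((g p).φ x)) * ((g p)⁻¹.dφ ((g p).φ x)).det * _ = _
  rw [mul_assoc, SliceGroup.det_dφ_inv_mul_det_dφ hM', mul_one, Equiv.symm_apply_apply]

theorem val_inducedState_θ (s : ℝ) (D₀ : Den M) (θ₀ : Fun M) (a p : P) (x : M) :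
    val (inducedState hg hM' s D₀ θ₀ a p).θ ((g p).φ x) = val θ₀ x - s * (g p).v x := by
  change val θ₀ ((g p).φ.symm ((g p).φ x)) + s * -(g p).v ((g p).φ.symm ((g p).φ x)) = _
  rw [Equiv.symm_apply_apply, mul_neg, sub_eq_add_neg]

end GroupFamily

section TwoParameters

variable {M : Set Plane} {g : ℝ × ℝ → SliceGroup M} (hg : SmoothGroupFamily g)
  (hM' : M ⊆ closure (interior M)) (s : ℝ) (D₀ : Den M) (θ₀ : Fun M)

theorem isInducedBy_inducedState (e : ℝ) : IsInducedBy s D₀ θ₀ (fun t => g (e, t))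
    fun t => inducedState hg hM' s D₀ θ₀ (0, 1) (e, t) := by
  refine fun t x => ⟨?_, ?_, val_inducedState_D_mul_det hg hM' s D₀ θ₀ _ _ x, rfl⟩
  · rw [deriv_prodMk_right (hg.1.differentiable x (e, t))]
    exact vval_eulerianVelocity hg _ _ x
  · rw [deriv_prodMk_right (hg.2.2.differentiable x (e, t))]
    exact val_pushDeriv hg hg.2.2 _ _ x

/-- The generator `(v_S, v_T) = (δφ φ⁻¹, φ_* δv)` of a two-parameter family in `S`. -/
def generator (t : ℝ) : Alg M :=
  (eulerianVelocity hg (1, 0) (0, t), pushDeriv hg hg.2.2 (1, 0) (0, t))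

theorem isGenerator_generator : IsGenerator g (generator hg) := by
  refine fun t x => ⟨?_, ?_⟩
  · rw [deriv_prodMk_left (hg.1.differentiable x (0, t))]
    exact vval_eulerianVelocity hg _ _ x
  · rw [deriv_prodMk_left (hg.2.2.differentiable x (0, t))]
    exact val_pushDeriv hg hg.2.2 _ _ x

theorem smoothAlgFamily_generator : SmoothAlgFamily (generator hg) :=
  have hc : ContDiff ℝ ∞ fun t : ℝ => ((0, t) : ℝ × ℝ) := by fun_prop
  ⟨(smoothFamily_pushDeriv hg hg.1 _).comp_param hc,
    (smoothFamily_pushDeriv hg hg.2.2 _).comp_param hc⟩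

theorem velocity_inducedState (t : ℝ) :
    velocity (fun e => inducedState hg hM' s D₀ θ₀ (0, 1) (e, t)) 0 =
      constrainedVariation s (fun t => inducedState hg hM' s D₀ θ₀ (0, 1) (0, t))
        (generator hg) t := by
  have hq := smoothStateFamily_inducedState hg hM' s D₀ θ₀ (0, 1)
  simp only [velocity, constrainedVariation, Variation.mk.injEq]
  refine ⟨?_, ?_, ?_, ?_⟩ <;> ext1 x
  · have hv := (smoothFamily_pushDeriv hg hg.1 (1, 0)).differentiable x (0, t)
    have h := fderiv_pushDeriv_comm hg hM' hg.1 (1, 0) (0, 1) (0, t) x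
    have hu := (smoothFamily_pushDeriv hg hg.1 (0, 1)).differentiable x (0, t)
    rw [← deriv_prodMk_left hu, ← deriv_prodMk_right hv] at h
    simp only [ad, adVec, bracket, sub_neg_eq_add]
    exact (eq_sub_of_add_eq h).trans (add_sub_assoc _ _ _)
  · have hv := (smoothFamily_pushDeriv hg hg.2.2 (1, 0)).differentiable x (0, t)
    have h := fderiv_pushDeriv_comm hg hM' hg.2.2 (1, 0) (0, 1) (0, t) x
    have hu := (smoothFamily_pushDeriv hg hg.2.2 (0, 1)).differentiable x (0, t)
    rw [← deriv_prodMk_left hu, ← deriv_prodMk_right hv] at h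
    simp only [ad, lieFun, sub_sub_eq_add_sub]
    exact eq_sub_of_add_eq h
  · rw [deriv_prodMk_left (hq.2.2.1.differentiable x (0, t))]
    exact fderiv_density hg hM' hq.2.2.1 (val_inducedState_D_mul_det hg hM' s D₀ θ₀ _) _ _ x
  · rw [deriv_prodMk_left (hq.2.2.2.differentiable x (0, t))]
    exact fderiv_scalar hg hM' hq.2.2.2 (val_inducedState_θ hg hM' s D₀ θ₀ _) _ _ x

end TwoParameters

/-! ### The variation of the action -/

section Action

theorem exists_pos_forall_closedBall_contDiffAt {F : Type*} [NormedAddCommGroup F]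
    [NormedSpace ℝ F] {f : ℝ × ℝ → F} {e₀ : ℝ} {K : Set ℝ} (hK : IsCompact K)
    (hf : ∀ t ∈ K, ContDiffAt ℝ 1 f (e₀, t)) :
    ∃ r > 0, ∀ e ∈ Metric.closedBall e₀ r, ∀ t ∈ K, ContDiffAt ℝ 1 f (e, t) := by
  have hev : ∀ᶠ e in nhds e₀, ∀ t ∈ K, ContDiffAt ℝ 1 f (e, t) :=
    hK.eventually_forall_of_forall_eventually fun t ht => (hf t ht).eventually (by simp)
  exact Metric.nhds_basis_closedBall.eventually_iff.1 hev

theorem hasDerivAt_intervalIntegral_of_contDiffAt {F : Type*} [NormedAddCommGroup F]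
    [NormedSpace ℝ F] {f : ℝ × ℝ → F} {e₀ t₀ t₁ : ℝ} (h01 : t₀ ≤ t₁)
    (hf : ∀ t ∈ Icc t₀ t₁, ContDiffAt ℝ 1 f (e₀, t)) :
    HasDerivAt (fun e => ∫ t in t₀..t₁, f (e, t))
      (∫ t in t₀..t₁, deriv (fun e => f (e, t)) e₀) e₀ := by
  obtain ⟨r, hr, hmem⟩ := exists_pos_forall_closedBall_contDiffAt isCompact_Icc hf
  have he₀ : e₀ ∈ Metric.closedBall e₀ r := Metric.mem_closedBall_self hr.le
  have hI : uIoc t₀ t₁ ⊆ Icc t₀ t₁ := uIoc_of_le h01 ▸ Ioc_subset_Icc_self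
  have hdiff : ∀ e ∈ Metric.closedBall e₀ r, ∀ t ∈ Icc t₀ t₁, DifferentiableAt ℝ f (e, t) :=
    fun e he t ht => (hmem e he t ht).differentiableAt (by simp)
  have hf' : ContinuousOn (fun p => fderiv ℝ f p (1, 0)) (Metric.closedBall e₀ r ×ˢ Icc t₀ t₁) :=
    fun p hp => (((hmem _ hp.1 _ hp.2).fderiv_right (m := 0) (by simp)).continuousAt.clm_apply
      continuousAt_const).continuousWithinAt
  obtain ⟨C, hC⟩ :=
    ((isCompact_closedBall e₀ r).prod isCompact_Icc).exists_bound_of_continuousOn hf'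
  have hslice : ∀ e ∈ Metric.closedBall e₀ r, ContinuousOn (fun t => f (e, t)) (Icc t₀ t₁) :=
    fun e he t ht => ((hdiff e he t ht).continuousAt.comp
      (Continuous.prodMk_right e).continuousAt).continuousWithinAt
  have hderiv : ∫ t in t₀..t₁, deriv (fun e => f (e, t)) e₀ =
      ∫ t in t₀..t₁, fderiv ℝ f (e₀, t) (1, 0) :=
    intervalIntegral.integral_congr fun t ht =>
      deriv_prodMk_left (hdiff e₀ he₀ t (uIcc_of_le h01 ▸ ht))
  rw [hderiv]
  refine (intervalIntegral.hasDerivAt_integral_of_dominated_loc_of_deriv_le (bound := fun _ => C)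
    (F' := fun e t => fderiv ℝ f (e, t) (1, 0)) (Metric.ball_mem_nhds e₀ hr) ?_
    (ContinuousOn.intervalIntegrable_of_Icc h01 (hslice e₀ he₀)) ?_
    (.of_forall fun t ht e he => hC (e, t) ⟨Metric.ball_subset_closedBall he, hI ht⟩)
    intervalIntegrable_const (.of_forall fun t ht e he => ?_)).2
  · filter_upwards [Metric.closedBall_mem_nhds e₀ hr] with e he
    exact ((hslice e he).mono hI).aestronglyMeasurable measurableSet_uIoc
  · exact (hf'.comp (Continuous.prodMk_right e₀).continuousOn
      fun t ht => ⟨he₀, hI ht⟩).aestronglyMeasurable measurableSet_uIoc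
  · exact (hdiff e (Metric.ball_subset_closedBall he) t (hI ht)).hasFDerivAt.comp_hasDerivAt e
      ((hasDerivAt_id e).prodMk (hasDerivAt_const e t))

variable {M : Set Plane}

theorem SmoothStateFamily.comp_param {P P' : Type*} [NormedAddCommGroup P] [NormedSpace ℝ P]
    [NormedAddCommGroup P'] [NormedSpace ℝ P'] {q : P → State M} (hq : SmoothStateFamily q)
    {c : P' → P} (hc : ContDiff ℝ ∞ c) : SmoothStateFamily fun p => q (c p) :=
  ⟨hq.1.comp_param hc, hq.2.1.comp_param hc, hq.2.2.1.comp_param hc, hq.2.2.2.comp_param hc⟩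

theorem hasDerivAt_action {ℓ : State M → ℝ} {t₀ t₁ : ℝ} (h01 : t₀ ≤ t₁) {q : ℝ → State M}
    {μ : ℝ → Costate M} (hℓ : IsC1Along ℓ t₀ t₁ q)
    (hμ : ∀ t ∈ Icc t₀ t₁, IsVariationalDerivative ℓ (q t) (μ t)) {Q : ℝ × ℝ → State M}
    (hQ : IsDeformation q Q) :
    HasDerivAt (fun e => ∫ t in t₀..t₁, ℓ (Q (e, t)))
      (∫ t in t₀..t₁, pairing (μ t) (velocity (fun e => Q (e, t)) 0)) 0 := by
  refine (hasDerivAt_intervalIntegral_of_contDiffAt h01 (hℓ Q hQ)).congr_deriv ?_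
  refine intervalIntegral.integral_congr fun t ht => ?_
  obtain ⟨hsmooth, hQ0, R, hR⟩ := hQ
  exact (hμ t (uIcc_of_le h01 ▸ ht) (fun e => Q (e, t)) (hsmooth.comp_param (by fun_prop)) (hQ0 t)
    ⟨R, fun e => hR (e, t)⟩).deriv

end Action

/-! ### The pairing with a constrained variation -/

section Residuals

variable {M : Set Plane}

/-- A family of variations that depends smoothly on a parameter, jointly with the point. -/
def SmoothVariationFamily (w : ℝ → Variation M) : Prop :=
  SmoothFamily (fun t => (w t).uS) ∧ SmoothFamily (fun t => (w t).uT) ∧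
  SmoothFamily (fun t => (w t).D) ∧ SmoothFamily (fun t => (w t).θ)

/-- All four components of a variation vanish at a point. -/
def VanishesAt (w : Variation M) (x : M) : Prop :=
  w.uS x = 0 ∧ w.uT x = 0 ∧ w.D x = 0 ∧ w.θ x = 0

/-- The defect of the momentum equation. -/
def momentumResidual (q : ℝ → State M) (μ : ℝ → Costate M) (t : ℝ) (x : M) : Plane →L[ℝ] ℝ :=
  deriv (fun τ => val (μ τ).uS x) t + adStar (q t).u.1 (μ t).uS x -
    (diamondFun (μ t).uT (q t).u.2 x + diamondDen (μ t).D (q t).D x +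
      diamondFun (μ t).θ (q t).θ x)

/-- The defect of the tracer equation. -/
def tracerResidual (s : ℝ) (q : ℝ → State M) (μ : ℝ → Costate M) (t : ℝ) (x : M) : ℝ :=
  deriv (fun τ => val (μ τ).uT x) t + lieDen (q t).u.1 (μ t).uT x + s * val (μ t).θ x

theorem affineEulerPoincare_iff {s t₀ t₁ : ℝ} {q : ℝ → State M} {μ : ℝ → Costate M} :
    AffineEulerPoincare s t₀ t₁ q μ ↔ ∀ t ∈ Icc t₀ t₁, ∀ x : M,
      momentumResidual q μ t x = 0 ∧ tracerResidual s q μ t x = 0 := by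
  refine forall₂_congr fun t _ => forall_congr' fun x => and_congr ?_ ?_
  · rw [momentumResidual, sub_eq_zero]
  · rw [tracerResidual, eq_neg_iff_add_eq_zero, mul_comm]

/-- The integrand of `pairing`. -/
def pairingDensity (μ : Costate M) (w : Variation M) (x : M) : ℝ :=
  val μ.uS x (w.uS x) + val μ.uT x * w.uT x + val μ.D x * w.D x + val μ.θ x * w.θ x

/-- The density of the Noether pairing of the momenta `δℓ/δ(u_S, u_T)` with a generator. -/
def noetherDensity (μ : Costate M) (v : Alg M) (x : M) : ℝ :=
  val μ.uS x (vval v.1 x) + val μ.uT x * val v.2 x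

/-- The density of the pairing of the two residuals with a generator. -/
def residualDensity (s : ℝ) (q : ℝ → State M) (μ : ℝ → Costate M) (v : ℝ → Alg M) (t : ℝ)
    (x : M) : ℝ :=
  momentumResidual q μ t x (vval (v t).1 x) + tracerResidual s q μ t x * val (v t).2 x

section Smoothness

variable {q : ℝ → State M} {μ : ℝ → Costate M} {v : ℝ → Alg M}

theorem SmoothFamily.noetherDensity (hμ : SmoothCostateFamily μ) (hv : SmoothAlgFamily v) :
    SmoothFamily fun t => noetherDensity (μ t) (v t) :=
  (hμ.1.clm_apply hv.1).add (hμ.2.1.mul hv.2)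

theorem deriv_noetherDensity (hμ : SmoothCostateFamily μ) (hv : SmoothAlgFamily v) (t : ℝ)
    (x : M) : deriv (fun τ => VSM.noetherDensity (μ τ) (v τ) x) t =
      deriv (fun τ => val (μ τ).uS x) t (vval (v t).1 x) +
        val (μ t).uS x (deriv (fun τ => vval (v τ).1 x) t) +
        (deriv (fun τ => val (μ τ).uT x) t * val (v t).2 x +
        val (μ t).uT x * deriv (fun τ => val (v τ).2 x) t) :=
  (((hμ.1.differentiable x t).hasDerivAt.clm_apply (hv.1.differentiable x t).hasDerivAt).add
    ((hμ.2.1.differentiable x t).hasDerivAt.mul (hv.2.differentiable x t).hasDerivAt)).deriv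

variable (hM' : M ⊆ closure (interior M))

include hM'

theorem SmoothFamily.dv {P : Type*} [NormedAddCommGroup P] [NormedSpace ℝ P] {u : P → Vec M}
    (hu : SmoothFamily fun p => vval (u p)) : SmoothFamily fun p => dv (u p) :=
  SmoothFamily.d hM' hu

theorem SmoothFamily.div {P : Type*} [NormedAddCommGroup P] [NormedSpace ℝ P] {u : P → Vec M}
    (hu : SmoothFamily fun p => vval (u p)) : SmoothFamily fun p => div (u p) :=
  (SmoothFamily.dv hM' hu).map
    (Φ := fun A : Plane →L[ℝ] Plane => ∑ i : Fin 2, A (EuclideanSpace.single i 1) i) (by fun_prop)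

theorem SmoothFamily.lieFun {P : Type*} [NormedAddCommGroup P] [NormedSpace ℝ P] {u : P → Vec M}
    {a : P → Fun M} (hu : SmoothFamily fun p => vval (u p)) (ha : SmoothFamily fun p => val (a p)) :
    SmoothFamily fun p => lieFun (u p) (a p) :=
  (SmoothFamily.d hM' ha).clm_apply hu

theorem SmoothFamily.lieDen {P : Type*} [NormedAddCommGroup P] [NormedSpace ℝ P] {u : P → Vec M}
    {a : P → Den M} (hu : SmoothFamily fun p => vval (u p)) (ha : SmoothFamily fun p => val (a p)) :
    SmoothFamily fun p => lieDen (u p) (a p) :=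
  ((SmoothFamily.d hM' ha).clm_apply hu).add (ha.mul (SmoothFamily.div hM' hu))

theorem SmoothFamily.adVec {P : Type*} [NormedAddCommGroup P] [NormedSpace ℝ P] {u v : P → Vec M}
    (hu : SmoothFamily fun p => vval (u p)) (hv : SmoothFamily fun p => vval (v p)) :
    SmoothFamily fun p => adVec (u p) (v p) :=
  (((SmoothFamily.dv hM' hv).clm_apply hu).sub ((SmoothFamily.dv hM' hu).clm_apply hv)).neg

theorem SmoothFamily.adStar {P : Type*} [NormedAddCommGroup P] [NormedSpace ℝ P] {u : P → Vec M}
    {m : P → OneFormDen M} (hu : SmoothFamily fun p => vval (u p))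
    (hm : SmoothFamily fun p => val (m p)) : SmoothFamily fun p => adStar (u p) (m p) :=
  (((SmoothFamily.d hM' hm).clm_apply hu).add (hm.clm_comp (SmoothFamily.dv hM' hu))).add
    ((SmoothFamily.div hM' hu).smul hm)

theorem SmoothFamily.momentumResidual (hq : SmoothStateFamily q) (hμ : SmoothCostateFamily μ) :
    SmoothFamily (momentumResidual q μ) :=
  (hμ.1.deriv.add (.adStar hM' hq.1 hμ.1)).sub
    (((hμ.2.1.smul (.d hM' hq.2.1)).neg.add (hq.2.2.1.smul (.d hM' hμ.2.2.1))).add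
      (hμ.2.2.2.smul (.d hM' hq.2.2.2)).neg)

theorem SmoothFamily.tracerResidual (s : ℝ) (hq : SmoothStateFamily q)
    (hμ : SmoothCostateFamily μ) : SmoothFamily (tracerResidual s q μ) :=
  (hμ.2.1.deriv.add (.lieDen hM' hq.1 hμ.2.1)).add
    ((smoothFamily_param contDiff_const).mul hμ.2.2.2)

theorem SmoothFamily.residualDensity (s : ℝ) (hq : SmoothStateFamily q)
    (hμ : SmoothCostateFamily μ) (hv : SmoothAlgFamily v) :
    SmoothFamily (residualDensity s q μ v) :=
  ((SmoothFamily.momentumResidual hM' hq hμ).clm_apply hv.1).add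
    ((SmoothFamily.tracerResidual hM' s hq hμ).mul hv.2)

theorem smoothVariationFamily_constrainedVariation (s : ℝ) (hq : SmoothStateFamily q)
    (hv : SmoothAlgFamily v) : SmoothVariationFamily (constrainedVariation s q v) :=
  ⟨hv.1.deriv.sub (.adVec hM' hq.1 hv.1),
    hv.2.deriv.sub ((SmoothFamily.lieFun hM' hv.1 hq.2.1).sub (.lieFun hM' hq.1 hv.2)),
    (SmoothFamily.lieDen hM' hv.1 hq.2.2.1).neg,
    (SmoothFamily.lieFun hM' hv.1 hq.2.2.2).neg.sub
      ((smoothFamily_param contDiff_const).mul hv.2)⟩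

end Smoothness

section Pairing

variable {q : ℝ → State M} {μ : ℝ → Costate M} {v : ℝ → Alg M}
  (hM' : M ⊆ closure (interior M))

include hM'

theorem vanishesAt_constrainedVariation (s : ℝ) (q : ℝ → State M) {U : Set Plane} (hU : IsOpen U)
    (h : ∀ t (x : M), (x : Plane) ∈ U → vval (v t).1 x = 0 ∧ val (v t).2 x = 0) {x : M}
    (hx : (x : Plane) ∈ U) (t : ℝ) :
    VanishesAt (constrainedVariation s q v t) x := by
  have hS : ∀ τ, vval (v τ).1 x = 0 := fun τ => (h τ x hx).1
  have hT : ∀ τ, val (v τ).2 x = 0 := fun τ => (h τ x hx).2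
  have hdS : dv (v t).1 x = 0 := d_eq_zero_of_eventually hM' <| by
    filter_upwards [hU.mem_nhds hx] with y hy hyM using (h t ⟨y, hyM⟩ hy).1
  have hdT : d (v t).2 x = 0 := d_eq_zero_of_eventually hM' <| by
    filter_upwards [hU.mem_nhds hx] with y hy hyM using (h t ⟨y, hyM⟩ hy).2
  simp [VanishesAt, constrainedVariation, ad, adVec, bracket, lieFun, lieDen, div, hS, hT, hdS, hdT]

theorem pairingDensity_constrainedVariation (s : ℝ) (q : ℝ → State M)
    (hμ : SmoothCostateFamily μ) (hv : SmoothAlgFamily v) (t : ℝ) (x : M) :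
    pairingDensity (μ t) (constrainedVariation s q v t) x =
      deriv (fun τ => noetherDensity (μ τ) (v τ) x) t - residualDensity s q μ v t x +
        lieDen (q t).u.1 (Smooth.bilin (.id ℝ _) (μ t).uS ((v t).1 : Smooth M Plane)) x +
        lieDen (q t).u.1 (Smooth.bilin (.mul ℝ ℝ) (μ t).uT (v t).2) x -
        lieDen (v t).1 (Smooth.bilin (.mul ℝ ℝ) (q t).D (μ t).D) x := by
  rw [deriv_noetherDensity hμ hv, lieDen_contract hM', lieDen_mul hM', lieDen_mul hM']
  simp only [pairingDensity, constrainedVariation, ad, residualDensity, momentumResidual,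
    tracerResidual, diamondFun, diamondDen, lieFun, map_sub, add_apply, sub_apply, neg_apply,
    smul_apply, smul_eq_mul]
  ring

end Pairing

end Residuals

/-! ### Hamilton's principle -/

section SpaceTime

variable {M : Set Plane}

theorem sigmaFinite_area (hM : IsClosed M) : SigmaFinite (area M) := by
  have := hM.weaklyLocallyCompactSpace
  have := isFiniteMeasureOnCompacts_area hM
  infer_instance

theorem SmoothFamily.continuous_right {F : Type*} [NormedAddCommGroup F] [NormedSpace ℝ F]
    {f : ℝ → M → F} (hf : SmoothFamily f) (t : ℝ) : Continuous (f t) :=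
  hf.continuous.comp (.prodMk_right t)

theorem SmoothFamily.integrable_prod (hM : IsClosed M) {f : ℝ → M → ℝ} (hf : SmoothFamily f)
    {R : ℝ} (h : ∀ t (x : M), R < ‖(x : Plane)‖ → f t x = 0) (t₀ t₁ : ℝ) :
    Integrable (Function.uncurry f) ((volume.restrict (Ioc t₀ t₁)).prod (area M)) := by
  have := isFiniteMeasureOnCompacts_area hM
  have := sigmaFinite_area hM
  have hK : IsCompact (Icc t₀ t₁ ×ˢ (Subtype.val ⁻¹' Metric.closedBall 0 R : Set M)) :=
    isCompact_Icc.prod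
      (hM.isClosedEmbedding_subtypeVal.isCompact_preimage (isCompact_closedBall 0 R))
  have hint := hf.continuous.continuousOn.integrableOn_compact (μ := volume.prod (area M)) hK
  rw [← Measure.restrict_univ (μ := area M), Measure.prod_restrict]
  refine IntegrableOn.of_forall_sdiff_eq_zero hint (measurableSet_Ioc.prod .univ) fun z hz => ?_
  exact h z.1 z.2 (not_le.1 fun hx =>
    hz.2 ⟨Ioc_subset_Icc_self hz.1.1, mem_closedBall_zero_iff.2 hx⟩)

theorem SmoothFamily.intervalIntegrable_integral (hM : IsClosed M) {f : ℝ → M → ℝ}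
    (hf : SmoothFamily f) {R : ℝ} (h : ∀ t (x : M), R < ‖(x : Plane)‖ → f t x = 0) {t₀ t₁ : ℝ}
    (h01 : t₀ ≤ t₁) : IntervalIntegrable (fun t => ∫ x, f t x ∂(area M)) volume t₀ t₁ := by
  have := sigmaFinite_area hM
  rw [intervalIntegrable_iff_integrableOn_Ioc_of_le h01]
  exact (hf.integrable_prod hM h t₀ t₁).integral_prod_left

theorem SmoothFamily.intervalIntegral_integral_deriv (hM : IsClosed M) {f : ℝ → M → ℝ}
    (hf : SmoothFamily f) {R : ℝ} (h : ∀ t (x : M), R < ‖(x : Plane)‖ → f t x = 0) {t₀ t₁ : ℝ}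
    (h01 : t₀ ≤ t₁) :
    ∫ t in t₀..t₁, ∫ x, _root_.deriv (fun τ => f τ x) t ∂(area M) =
      ∫ x, (f t₁ x - f t₀ x) ∂(area M) := by
  have := sigmaFinite_area hM
  have hderiv : ∀ t (x : M), R < ‖(x : Plane)‖ → _root_.deriv (fun τ => f τ x) t = 0 :=
    fun t x hx => by simp [h _ x hx]
  rw [intervalIntegral.integral_of_le h01,
    integral_integral_swap (hf.deriv.integrable_prod hM hderiv t₀ t₁)]
  refine integral_congr_ae (.of_forall fun x => ?_)
  change ∫ t in Ioc t₀ t₁, _root_.deriv (fun τ => f τ x) t = f t₁ x - f t₀ x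
  rw [← intervalIntegral.integral_of_le h01]
  exact intervalIntegral.integral_deriv_eq_sub (fun t _ => hf.differentiable x t)
    ((hf.deriv.contDiff x).continuous.intervalIntegrable _ _)

theorem integral_eq_intervalIntegral_area (hM : IsClosed M) {t₀ t₁ : ℝ} (h01 : t₀ ≤ t₁)
    {f : ℝ × Plane → ℝ} (hf : Integrable f) (h : ∀ z ∉ Ioc t₀ t₁ ×ˢ M, f z = 0) :
    ∫ z, f z = ∫ t in t₀..t₁, ∫ x : M, f (t, x) ∂(area M) := by
  have hspace : ∀ t, ∫ x : M, f (t, x) ∂(area M) = ∫ x, f (t, x) := fun t =>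
    (integral_subtype_comap hM.measurableSet fun x => f (t, x)).trans
      (setIntegral_eq_integral_of_forall_compl_eq_zero fun x hx => h _ fun hz => hx hz.2)
  rw [Measure.volume_eq_prod] at hf ⊢
  rw [integral_prod _ hf, intervalIntegral.integral_of_le h01]
  simp_rw [hspace]
  refine (setIntegral_eq_integral_of_forall_compl_eq_zero fun t ht => ?_).symm
  simp [h (t, _) fun hz => ht hz.1]

theorem SmoothFamily.eq_zero_of_forall_integral_mul_eq_zero (hM : IsClosed M)
    (hM' : M ⊆ closure (interior M)) {t₀ t₁ : ℝ} (h01 : t₀ < t₁) {f : ℝ → M → ℝ}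
    (hf : SmoothFamily f)
    (h : ∀ g : ℝ × Plane → ℝ, ContDiff ℝ ∞ g → HasCompactSupport g →
      tsupport g ⊆ Ioo t₀ t₁ ×ˢ interior M →
      ∫ t in t₀..t₁, ∫ x : M, g (t, x) * f t x ∂(area M) = 0) {t : ℝ} (ht : t ∈ Icc t₀ t₁)
    (x : M) : f t x = 0 := by
  obtain ⟨F, hF, e⟩ := hf
  have hFc : Continuous F := hF.continuous
  have hO : IsOpen (Ioo t₀ t₁ ×ˢ interior M) := isOpen_Ioo.prod isOpen_interior
  have hsub : Ioo t₀ t₁ ×ˢ interior M ⊆ Ioc t₀ t₁ ×ˢ M :=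
    prod_mono Ioo_subset_Ioc_self interior_subset
  have hae := hO.ae_eq_zero_of_integral_contDiff_smul_eq_zero (μ := volume)
    (hFc.locallyIntegrable.locallyIntegrableOn _) fun g hg hgc hgs => by
      have hint : Integrable fun z => g z • F z :=
        (hg.continuous.smul hFc).integrable_of_hasCompactSupport hgc.smul_right
      have hout : ∀ z ∉ Ioc t₀ t₁ ×ˢ M, g z • F z = 0 := fun z hz => by
        rw [image_eq_zero_of_notMem_tsupport fun h => hz (hsub (hgs h)), zero_smul]
      rw [integral_eq_intervalIntegral_area hM h01.le hint hout]
      simpa only [e, smul_eq_mul] using h g hg hgc hgs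
  have hon : EqOn F (fun _ => 0) (Ioo t₀ t₁ ×ˢ interior M) :=
    Measure.eqOn_open_of_ae_eq ((ae_restrict_iff' hO.measurableSet).2 hae) hO hFc.continuousOn
      continuousOn_const
  have hclosure : (t, (x : Plane)) ∈ closure (Ioo t₀ t₁ ×ˢ interior M) := by
    rw [closure_prod_eq, closure_Ioo h01.ne]
    exact ⟨ht, hM' x.2⟩
  rw [e]
  exact closure_minimal hon (isClosed_eq hFc continuous_const) hclosure

end SpaceTime

section Hamilton

variable {M : Set Plane}

theorem pairing_eq_integral (hM : IsClosed M) (μ : Costate M) {w : ℝ → Variation M}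
    (hw : SmoothVariationFamily w) {t R : ℝ}
    (h : ∀ x : M, R < ‖(x : Plane)‖ → VanishesAt (w t) x) :
    pairing μ (w t) = ∫ x, pairingDensity μ (w t) x ∂(area M) := by
  have hS : Continuous (w t).uS := hw.1.continuous_right t
  have hT : Continuous (w t).uT := hw.2.1.continuous_right t
  have hD : Continuous (w t).D := hw.2.2.1.continuous_right t
  have hθ : Continuous (w t).θ := hw.2.2.2.continuous_right t
  have iS : Integrable (fun x => val μ.uS x ((w t).uS x)) (area M) :=
    integrable_of_bddSupp hM (by fun_prop) fun x hx => by rw [(h x hx).1, map_zero]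
  have iT : Integrable (fun x => val μ.uT x * (w t).uT x) (area M) :=
    integrable_of_bddSupp hM (by fun_prop) fun x hx => by rw [(h x hx).2.1, mul_zero]
  have iD : Integrable (fun x => val μ.D x * (w t).D x) (area M) :=
    integrable_of_bddSupp hM (by fun_prop) fun x hx => by rw [(h x hx).2.2.1, mul_zero]
  have iθ : Integrable (fun x => val μ.θ x * (w t).θ x) (area M) :=
    integrable_of_bddSupp hM (by fun_prop) fun x hx => by rw [(h x hx).2.2.2, mul_zero]
  unfold pairingDensity pairing pairVec pairFun
  symm
  refine (integral_add ((iS.add iT).add iD) iθ).trans ?_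
  rw [integral_add' (iS.add iT) iD, integral_add' iS iT]

variable {q : ℝ → State M} {μ : ℝ → Costate M} {v : ℝ → Alg M} {t₀ t₁ : ℝ}
  (hM' : M ⊆ closure (interior M)) (hM : IsClosed M) (hq : SmoothStateFamily q)
  (hμ : SmoothCostateFamily μ)

include hM' hM hq hμ

theorem pairing_constrainedVariation (s : ℝ) (hv : SmoothAlgFamily v) {R : ℝ}
    (h : ∀ t (x : M), R < ‖(x : Plane)‖ → vval (v t).1 x = 0 ∧ val (v t).2 x = 0) (t : ℝ) :
    pairing (μ t) (constrainedVariation s q v t) =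
      ∫ x, deriv (fun τ => noetherDensity (μ τ) (v τ) x) t ∂(area M) -
        ∫ x, residualDensity s q μ v t x ∂(area M) := by
  have hvanish : ∀ x : M, R < ‖(x : Plane)‖ → VanishesAt (constrainedVariation s q v t) x :=
    fun x hx => vanishesAt_constrainedVariation hM' s q
      (isOpen_lt continuous_const continuous_norm) h hx t
  have hNc : Continuous fun x => deriv (fun τ => noetherDensity (μ τ) (v τ) x) t :=
    (SmoothFamily.noetherDensity hμ hv).deriv.continuous_right t
  have hrc : Continuous (residualDensity s q μ v t) :=
    (SmoothFamily.residualDensity hM' s hq hμ hv).continuous_right t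
  have hN : Integrable (fun x => deriv (fun τ => noetherDensity (μ τ) (v τ) x) t) (area M) :=
    integrable_of_bddSupp hM hNc (R := R) fun x hx => by
      simp only [noetherDensity, h _ x hx, map_zero, mul_zero, add_zero, deriv_const]
  have hr : Integrable (residualDensity s q μ v t) (area M) :=
    integrable_of_bddSupp hM hrc (R := R) fun x hx => by
      simp only [residualDensity, h _ x hx, map_zero, mul_zero, add_zero]
  have h1 : BddSupp (Vec.smul (Smooth.bilin (.id ℝ _) (μ t).uS ((v t).1 : Smooth M Plane))
      (q t).u.1) :=
    bddSupp_smul_of_left (fun x hx => val_contract_eq_zero _ (h t x hx).1) _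
  have h2 : BddSupp (Vec.smul (Smooth.bilin (.mul ℝ ℝ) (μ t).uT (v t).2) (q t).u.1) :=
    bddSupp_smul_of_left (fun x hx => by rw [val_bilin, (h t x hx).2, map_zero]) _
  have h3 : BddSupp (Vec.smul (Smooth.bilin (.mul ℝ ℝ) (q t).D (μ t).D) (v t).1) :=
    bddSupp_smul_of_right _ fun x hx => (h t x hx).1
  have i1 := integrable_lieDen hM' hM h1
  have i2 := integrable_lieDen hM' hM h2
  rw [pairing_eq_integral hM (μ t) (smoothVariationFamily_constrainedVariation hM' s hq hv) hvanish,
    integral_congr_ae (.of_forall (pairingDensity_constrainedVariation hM' s q hμ hv t))]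
  refine (integral_sub (((hN.sub hr).add i1).add i2) (integrable_lieDen hM' hM h3)).trans ?_
  rw [integral_add' ((hN.sub hr).add i1) i2, integral_add' (hN.sub hr) i1, integral_sub' hN hr,
    integral_lieDen_eq_zero hM' hM h1, integral_lieDen_eq_zero hM' hM h2,
    integral_lieDen_eq_zero hM' hM h3, add_zero, add_zero, sub_zero]

theorem intervalIntegral_pairing (s : ℝ) (h01 : t₀ ≤ t₁) (hv : IsAdmissible t₀ t₁ v) :
    ∫ t in t₀..t₁, pairing (μ t) (constrainedVariation s q v t) =
      - ∫ t in t₀..t₁, ∫ x, residualDensity s q μ v t x ∂(area M) := by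
  obtain ⟨hv, hv₀, hv₁, R, hR⟩ := hv
  have hN := SmoothFamily.noetherDensity hμ hv
  have hNR : ∀ t (x : M), R < ‖(x : Plane)‖ → noetherDensity (μ t) (v t) x = 0 :=
    fun t x hx => by simp [noetherDensity, hR t x hx]
  have hN' : ∀ t (x : M), R < ‖(x : Plane)‖ →
      deriv (fun τ => noetherDensity (μ τ) (v τ) x) t = 0 := fun t x hx => by simp [hNR _ x hx]
  have hr : ∀ t (x : M), R < ‖(x : Plane)‖ → residualDensity s q μ v t x = 0 :=
    fun t x hx => by simp [residualDensity, hR t x hx]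
  have hN0 : ∀ x, noetherDensity (μ t₁) (v t₁) x - noetherDensity (μ t₀) (v t₀) x = 0 :=
    fun x => by simp [noetherDensity, hv₀, hv₁, vval, val]
  simp_rw [pairing_constrainedVariation hM' hM hq hμ s hv hR]
  rw [intervalIntegral.integral_sub (hN.deriv.intervalIntegrable_integral hM hN' h01)
    ((SmoothFamily.residualDensity hM' s hq hμ hv).intervalIntegrable_integral hM hr h01),
    hN.intervalIntegral_integral_deriv hM hNR h01]
  simp [hN0]

variable {ℓ : State M → ℝ} (hℓ : IsC1Along ℓ t₀ t₁ q)
  (hℓμ : ∀ t ∈ Icc t₀ t₁, IsVariationalDerivative ℓ (q t) (μ t))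

include hℓ hℓμ

theorem hasDerivAt_action_constrainedVariation (s : ℝ) (h01 : t₀ ≤ t₁) {Q : ℝ × ℝ → State M}
    (hQ : IsDeformation q Q) (hv : IsAdmissible t₀ t₁ v)
    (hvar : ∀ t ∈ Icc t₀ t₁, velocity (fun e => Q (e, t)) 0 = constrainedVariation s q v t) :
    HasDerivAt (fun e => ∫ t in t₀..t₁, ℓ (Q (e, t)))
      (- ∫ t in t₀..t₁, ∫ x, residualDensity s q μ v t x ∂(area M)) 0 := by
  refine (hasDerivAt_action h01 hℓ hℓμ hQ).congr_deriv ?_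
  rw [← intervalIntegral_pairing hM' hM hq hμ s h01 hv]
  exact intervalIntegral.integral_congr fun t ht =>
    congrArg (pairing (μ t)) (hvar t (uIcc_of_le h01 ▸ ht))

theorem AffineEulerPoincare.hamiltonPrinciple {s : ℝ} (h01 : t₀ ≤ t₁)
    (h : AffineEulerPoincare s t₀ t₁ q μ) : HamiltonPrinciple s ℓ t₀ t₁ q := by
  intro Q v hQ hv hvar
  refine
    (hasDerivAt_action_constrainedVariation hM' hM hq hμ hℓ hℓμ s h01 hQ hv hvar).congr_deriv ?_
  rw [neg_eq_zero]
  refine (intervalIntegral.integral_congr fun t ht => ?_).trans intervalIntegral.integral_zero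
  have hres := affineEulerPoincare_iff.1 h t (uIcc_of_le h01 ▸ ht)
  simp [residualDensity, hres]

end Hamilton

section Perturbation

variable {M : Set Plane}

theorem mem_Vec_of_eq_zero {w : Smooth M Plane}
    (h : ∀ x : M, (x : Plane) ∉ interior M → val w x = 0) : w ∈ Vec M := by
  intro p y hy
  by_cases hp : (p : Plane) ∈ interior M
  · simpa [val] using
      inner_fderiv_sub_eq_zero differentiableAt_id (mem_interior_iff_mem_nhds.1 hp) hy
      (val w p)
  · rw [show (w : M → Plane) p = 0 from h p hp, inner_zero_left]

theorem SmoothFamily.add_smul {F : Type*} [NormedAddCommGroup F] [NormedSpace ℝ F]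
    {f w : ℝ → M → F} (hf : SmoothFamily f) (hw : SmoothFamily w) :
    SmoothFamily fun (p : ℝ × ℝ) x => f p.2 x + p.1 • w p.2 x :=
  (hf.comp_param contDiff_snd).add
    ((smoothFamily_param contDiff_fst).smul (hw.comp_param contDiff_snd))

theorem deriv_add_smul_const {F : Type*} [NormedAddCommGroup F] [NormedSpace ℝ F] (a b : F)
    (e : ℝ) : deriv (fun r : ℝ => a + r • b) e = b := by
  simpa using (((hasDerivAt_id e).smul_const b).const_add a).deriv

variable {w : ℝ → Variation M} (hw : SmoothVariationFamily w)
  (hwM : ∀ t (x : M), (x : Plane) ∉ interior M → (w t).uS x = 0)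

/-- The family of states `q t + ε w t` with parameters `(ε, t)`. The velocity component of `w`
vanishes on the boundary, so that adding it preserves tangency. -/
def perturbation (q : ℝ → State M) (p : ℝ × ℝ) : State M where
  u := ((q p.2).u.1 + p.1 • ⟨⟨(w p.2).uS, hw.1.mem_smooth p.2⟩, mem_Vec_of_eq_zero (hwM p.2)⟩,
    (q p.2).u.2 + p.1 • ⟨(w p.2).uT, hw.2.1.mem_smooth p.2⟩)
  D := (q p.2).D + p.1 • ⟨(w p.2).D, hw.2.2.1.mem_smooth p.2⟩
  θ := (q p.2).θ + p.1 • ⟨(w p.2).θ, hw.2.2.2.mem_smooth p.2⟩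

theorem isDeformation_perturbation {q : ℝ → State M} (hq : SmoothStateFamily q) {R : ℝ}
    (hR : ∀ t (x : M), R < ‖(x : Plane)‖ → VanishesAt (w t) x) :
    IsDeformation q (perturbation hw hwM q) := by
  refine ⟨⟨hq.1.add_smul hw.1, hq.2.1.add_smul hw.2.1, hq.2.2.1.add_smul hw.2.2.1,
    hq.2.2.2.add_smul hw.2.2.2⟩, fun t => ?_, R, fun p x hx => ?_⟩
  · simp only [perturbation, zero_smul, add_zero]
  · obtain ⟨hS, hT, hD, hθ⟩ := hR p.2 x hx
    simp [EqAt, perturbation, vval, val, hS, hT, hD, hθ]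

theorem velocity_perturbation (q : ℝ → State M) (e t : ℝ) :
    velocity (fun r => perturbation hw hwM q (r, t)) e = w t := by
  change Variation.mk _ _ _ _ = Variation.mk _ _ _ _
  congr 1 <;> ext1 x
  · exact deriv_add_smul_const (vval (q t).u.1 x) ((w t).uS x) e
  · exact deriv_add_smul_const (val (q t).u.2 x) ((w t).uT x) e
  · exact deriv_add_smul_const (val (q t).D x) ((w t).D x) e
  · exact deriv_add_smul_const (val (q t).θ x) ((w t).θ x) e

end Perturbation

section TestGenerator

variable {M : Set Plane} {g : ℝ × Plane → ℝ} (hg : ContDiff ℝ ∞ g)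
  (hgM : ∀ t, ∀ x ∉ interior M, g (t, x) = 0) (a : Plane) (b : ℝ)

/-- The curve `t ↦ (g a, g b)` in `𝔰`, for a scalar space-time field `g` that vanishes on the
boundary of `M`, used to test the equations. -/
def testGenerator (t : ℝ) : Alg M :=
  (⟨⟨fun x => g (t, x) • a, fun x => g (t, x) • a, by fun_prop, fun _ => rfl⟩,
      mem_Vec_of_eq_zero fun x hx => by simp [val, hgM t x hx]⟩,
    ⟨fun x => g (t, x) * b, fun x => g (t, x) * b, by fun_prop, fun _ => rfl⟩)

theorem testGenerator_vanishes {t : ℝ} {x : M} (h : g (t, x) = 0) :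
    vval (testGenerator hg hgM a b t).1 x = 0 ∧ val (testGenerator hg hgM a b t).2 x = 0 := by
  simp [testGenerator, vval, val, h]

theorem testGenerator_eq_zero {t : ℝ} (h : ∀ x, g (t, x) = 0) : testGenerator hg hgM a b t = 0 :=
  Prod.ext (Subtype.ext (Subtype.ext (funext fun x =>
      (testGenerator_vanishes hg hgM a b (h x)).1)))
    (Subtype.ext (funext fun x => (testGenerator_vanishes hg hgM a b (h x)).2))

theorem isAdmissible_testGenerator {t₀ t₁ : ℝ} (hgc : HasCompactSupport g)
    (h₀ : ∀ x, g (t₀, x) = 0) (h₁ : ∀ x, g (t₁, x) = 0) :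
    IsAdmissible t₀ t₁ (testGenerator hg hgM a b) := by
  obtain ⟨R, hR⟩ := hgc.isCompact.isBounded.exists_norm_le
  refine ⟨⟨⟨fun z => g z • a, by fun_prop, fun _ _ => rfl⟩,
    ⟨fun z => g z * b, by fun_prop, fun _ _ => rfl⟩⟩, testGenerator_eq_zero hg hgM a b h₀,
    testGenerator_eq_zero hg hgM a b h₁, R, fun t x hx => testGenerator_vanishes hg hgM a b ?_⟩
  exact image_eq_zero_of_notMem_tsupport fun h =>
    hx.not_ge ((norm_snd_le (t, (x : Plane))).trans (hR _ h))

end TestGenerator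

section WeakForm

variable {M : Set Plane} (hM' : M ⊆ closure (interior M)) (hM : IsClosed M) {s t₀ t₁ : ℝ}
  {q : ℝ → State M} {μ : ℝ → Costate M} {ℓ : State M → ℝ} (hq : SmoothStateFamily q)
  (hμ : SmoothCostateFamily μ) (hℓ : IsC1Along ℓ t₀ t₁ q)
  (hℓμ : ∀ t ∈ Icc t₀ t₁, IsVariationalDerivative ℓ (q t) (μ t))

include hM' hM hq hμ hℓ hℓμ

theorem HamiltonPrinciple.integral_residualDensity_eq_zero (h01 : t₀ ≤ t₁)
    (h : HamiltonPrinciple s ℓ t₀ t₁ q) {v : ℝ → Alg M} (hv : IsAdmissible t₀ t₁ v)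
    {U : Set Plane} (hU : IsOpen U) (hUM : (interior M)ᶜ ⊆ U)
    (hvU : ∀ t (x : M), (x : Plane) ∈ U → vval (v t).1 x = 0 ∧ val (v t).2 x = 0) :
    ∫ t in t₀..t₁, ∫ x, residualDensity s q μ v t x ∂(area M) = 0 := by
  obtain ⟨R, hR⟩ := hv.2.2.2
  have hw : SmoothVariationFamily (constrainedVariation s q v) :=
    smoothVariationFamily_constrainedVariation hM' s hq hv.1
  have hwM : ∀ t (x : M), (x : Plane) ∉ interior M → (constrainedVariation s q v t).uS x = 0 :=
    fun t x hx => (vanishesAt_constrainedVariation hM' s q hU hvU (hUM hx) t).1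
  have hdef : IsDeformation q (perturbation hw hwM q) :=
    isDeformation_perturbation hw hwM hq (R := R) fun t x hx =>
      vanishesAt_constrainedVariation hM' s q (isOpen_lt continuous_const continuous_norm) hR hx t
  have hvel : ∀ t ∈ Icc t₀ t₁, velocity (fun e => perturbation hw hwM q (e, t)) 0 =
      constrainedVariation s q v t := fun t _ => velocity_perturbation hw hwM q 0 t
  have hstat := (h _ v hdef hv hvel).unique
    (hasDerivAt_action_constrainedVariation hM' hM hq hμ hℓ hℓμ s h01 hdef hv hvel)
  exact neg_eq_zero.1 hstat.symm

theorem HamiltonPrinciple.affineEulerPoincare (h01 : t₀ < t₁)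
    (h : HamiltonPrinciple s ℓ t₀ t₁ q) : AffineEulerPoincare s t₀ t₁ q μ := by
  have hres : ∀ (a : Plane) (b : ℝ), ∀ t ∈ Icc t₀ t₁, ∀ x : M,
      momentumResidual q μ t x a + tracerResidual s q μ t x * b = 0 := by
    intro a b t ht x
    have hf : SmoothFamily fun t x => momentumResidual q μ t x a + tracerResidual s q μ t x * b :=
      ((SmoothFamily.momentumResidual hM' hq hμ).clm_apply (smoothFamily_param contDiff_const)).add
        ((SmoothFamily.tracerResidual hM' s hq hμ).mul (smoothFamily_param contDiff_const))
    refine hf.eq_zero_of_forall_integral_mul_eq_zero hM hM' h01 (fun g hg hgc hgs => ?_) ht x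
    have hg0 : ∀ t x, x ∉ Prod.snd '' tsupport g → g (t, x) = 0 := fun t x hx =>
      image_eq_zero_of_notMem_tsupport fun hz => hx ⟨(t, x), hz, rfl⟩
    have hsupp : Prod.snd '' tsupport g ⊆ interior M := image_subset_iff.2 fun z hz => (hgs hz).2
    have htime : ∀ t ∉ Ioo t₀ t₁, ∀ x, g (t, x) = 0 := fun t ht x =>
      image_eq_zero_of_notMem_tsupport fun hz => ht (hgs hz).1
    have hgM : ∀ t, ∀ x ∉ interior M, g (t, x) = 0 := fun t x hx => hg0 t x (mt (@hsupp x) hx)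
    have hweak := h.integral_residualDensity_eq_zero hM' hM hq hμ hℓ hℓμ h01.le
      (isAdmissible_testGenerator hg hgM a b hgc (htime t₀ (by simp)) (htime t₁ (by simp)))
      (hgc.isCompact.image continuous_snd).isClosed.isOpen_compl (compl_subset_compl.2 hsupp)
      fun t x hx => testGenerator_vanishes hg hgM a b (hg0 t x hx)
    convert hweak using 5 with t x
    simp only [residualDensity, testGenerator, vval, val, map_smul, smul_eq_mul]
    ring
  refine affineEulerPoincare_iff.2 fun t ht x => ⟨?_, ?_⟩
  · ext1 a
    simpa using hres a 0 t ht x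
  · simpa using hres 0 1 t ht x

end WeakForm

end VSM

end

open VSM in
theorem theorem2p1 (M : Set Plane) (hM : IsClosed M) (hM' : M ⊆ closure (interior M)) (s : ℝ) :
    -- the constrained variations follow from the definitions of the variables on the group
    (∀ g : ℝ × ℝ → SliceGroup M, SmoothGroupFamily g → ∀ (D₀ : Den M) (θ₀ : Fun M),
      ∃ (Q : ℝ × ℝ → State M) (v : ℝ → Alg M),
        SmoothStateFamily Q ∧ SmoothAlgFamily v ∧
        (∀ e : ℝ, IsInducedBy s D₀ θ₀ (fun t => g (e, t)) (fun t => Q (e, t))) ∧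
        IsGenerator g v ∧
        ∀ t : ℝ, velocity (fun e => Q (e, t)) 0 =
          constrainedVariation s (fun t => Q (0, t)) v t) ∧
    -- the coadjoint action and the diamonds are the duals of `ad` and of the Lie derivative
    (∀ (u v : Vec M) (m : OneFormDen M), BddSupp v →
      pairVec (adStar u m) (vval v) = pairVec (val m) (adVec u v)) ∧
    (∀ (v : Vec M) (b : Den M) (a : Fun M), BddSupp v →
      - pairVec (diamondFun b a) (vval v) = pairFun (lieFun v a) (val b)) ∧
    (∀ (v : Vec M) (b : Fun M) (D : Den M), BddSupp v →
      - pairVec (diamondDen b D) (vval v) = pairFun (lieDen v D) (val b)) ∧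
    -- Hamilton's principle is equivalent to the affine Euler–Poincaré equations
    (∀ (ℓ : State M → ℝ) (t₀ t₁ : ℝ), t₀ < t₁ →
      ∀ (q : ℝ → State M) (μ : ℝ → Costate M), SmoothStateFamily q → SmoothCostateFamily μ →
        IsC1Along ℓ t₀ t₁ q →
        (∀ t ∈ Set.Icc t₀ t₁, IsVariationalDerivative ℓ (q t) (μ t)) →
        (HamiltonPrinciple s ℓ t₀ t₁ q ↔ AffineEulerPoincare s t₀ t₁ q μ)) := by
  refine ⟨fun g hg D₀ θ₀ => ?_, fun u v m hv => pairVec_adStar hM' hM m hv,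
    fun v b a _ => pairVec_diamondFun v b a, fun v b D hv => pairVec_diamondDen hM' hM b D hv,
    fun ℓ t₀ t₁ h01 q μ hq hμ hℓ hℓμ => ?_⟩
  · exact ⟨inducedState hg hM' s D₀ θ₀ (0, 1), generator hg,
      smoothStateFamily_inducedState hg hM' s D₀ θ₀ (0, 1), smoothAlgFamily_generator hg,
      isInducedBy_inducedState hg hM' s D₀ θ₀, isGenerator_generator hg,
      velocity_inducedState hg hM' s D₀ θ₀⟩
  · exact ⟨fun h => h.affineEulerPoincare hM' hM hq hμ hℓ hℓμ h01,
      fun h => h.hamiltonPrinciple hM' hM hq hμ hℓ hℓμ h01.le⟩
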